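/- Let $H$ be a real separable Hilbert space. Assume the following. Hypothesis 1. (i) $A:D(A)\subset H\to H$ is the infinitesimal generator of a strongly continuous semigroup $(e^{tA})_{t\ge 0}$. (ii) $Q$ is a nonnegative self-adjoint bounded operator on $H$ with $\mathrm{Ker}(Q)=\{0\}$, and for every $t>0$ the operator $Q_t=\int_0^t e^{sA}Qe^{sA^*}\,ds$ (strong integral) is of trace class. (iii) $e^{tA}(H)\subset Q_t^{1/2}(H)$ for every $t>0$. (iv) With $\Lambda(t)=Q_t^{-1/2}e^{tA}$, there are $\delta\in(0,1)$ and $C_\delta>0$ such that $\|\Lambda(t)\|_{\mathcal L(H)}\le C_\delta/t^{\delta}$ for all $t>0$. Hypothesis 2. $u_0:H\to\mathbb R$ and $B:H\to H$ are bounded and measurable. For $t\ge 0$ let $N_{Q_t}$ be the centered Gaussian measure on $H$ with covariance operator $Q_t$, and set $S_tf(x)=\int_H f(e^{tA}x+y)\,N_{Q_t}(dy)$, that is, $S_tf(x)=\mathbb E f(Z_t^x)$ for the solution of $dZ_t^x=AZ_t^x\,dt+\sqrt Q\,dW_t$, $Z_0^x=x$. Define $$u^0(t,x)=S_tu_0(x),\qquad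 u^{n+1}(t,x)=S_tu_0(x)+\int_0^t \big(S_{t-s}\langle B,Du^n(s)\rangle\big)(x)\,ds ,$$ $v^0=u^0$ and $v^{n}=u^{n}-u^{n-1}$ for $n\ge 1$, where $D$ is the Fréchet derivative (gradient) in $x$. Then the iteration is well defined: for all $n\ge 0$ and $t>0$, $u^n(t,\cdot)$ is bounded and Fréchet differentiable with bounded derivative, $\langle B,Du^n(t)\rangle$ is bounded and measurable, and $s\mapsto \big(S_{t-s}\langle B,Du^n(s)\rangle\big)(x)$ is integrable on $[0,t]$ for every $x\in H$. Moreover, for every $T>0$ the series $$\sum_{n=0}^\infty v^n(t,x)$$ converges uniformly on $[0,T]\times H$, and for every $t_0\in(0,T)$ the series $$\sum_{n=0}^\infty Dv^n(t,x)$$ converges uniformly on $[t_0,T]\times H$. -/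

import Mathlib

open MeasureTheory ProbabilityTheory Filter Topology
open scoped RealInnerProductSpace

namespace KolmogorovSeries

noncomputable section

variable {H : Type*} [NormedAddCommGroup H] [InnerProductSpace ℝ H] [CompleteSpace H]

/-- `S t`, `t ≥ 0`, is a strongly continuous semigroup of bounded operators on `H`
(the values of `S` at negative times are irrelevant). -/
structure IsC0Semigroup (S : ℝ → H →L[ℝ] H) : Prop where
  map_zero : S 0 = ContinuousLinearMap.id ℝ H
  map_add : ∀ s t : ℝ, 0 ≤ s → 0 ≤ t → S (s + t) = (S s).comp (S t)
  tendsto_zero : ∀ x : H, Tendsto (fun t : ℝ => S t x) (𝓝[>] 0) (𝓝 x)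

/-- The (unbounded) operator `A` with domain `A.domain` is the infinitesimal generator of `S`:
`A x = lim_{t ↓ 0} (S t x - x) / t`, the domain being the set of all `x` for which the limit
exists. -/
structure IsInfinitesimalGenerator (A : H →ₗ.[ℝ] H) (S : ℝ → H →L[ℝ] H) : Prop where
  mem_domain_iff : ∀ x : H, x ∈ A.domain ↔
    ∃ y : H, Tendsto (fun t : ℝ => t⁻¹ • (S t x - x)) (𝓝[>] 0) (𝓝 y)
  tendsto_apply : ∀ x : A.domain,
    Tendsto (fun t : ℝ => t⁻¹ • (S t (x : H) - (x : H))) (𝓝[>] 0) (𝓝 (A x))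

open Classical in
/-- `Q_t = ∫₀ᵗ e^{sA} Q e^{sA*} ds`, the integral being understood in the strong sense: `Q_t` is the
bounded operator with `Q_t x = ∫₀ᵗ e^{sA} Q e^{sA*} x ds` for all `x`. (Such an operator exists for
every strongly continuous semigroup and every `t ≥ 0`; the value is `0` if there is none.) -/
def covOp (S : ℝ → H →L[ℝ] H) (Q : H →L[ℝ] H) (t : ℝ) : H →L[ℝ] H :=
  if h : ∃ T : H →L[ℝ] H, ∀ x : H,
      T x = ∫ s in (0 : ℝ)..t, S s (Q (ContinuousLinearMap.adjoint (S s) x)) then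
    h.choose
  else 0

/-- `T` is of trace class (nuclear): `T x = ∑ₖ ⟨aₖ, x⟩ bₖ` with `∑ₖ ‖aₖ‖ ‖bₖ‖ < ∞`. -/
def IsTraceClass (T : H →L[ℝ] H) : Prop :=
  ∃ a b : ℕ → H, Summable (fun k => ‖a k‖ * ‖b k‖) ∧
    ∀ x : H, HasSum (fun k => ⟪a k, x⟫ • b k) (T x)

open Classical in
/-- The square root `T^{1/2}` of a nonnegative self-adjoint bounded operator `T`: the unique
nonnegative self-adjoint `R` with `R ∘ R = T` (and `0` if there is none). -/
def opSqrt (T : H →L[ℝ] H) : H →L[ℝ] H :=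
  if h : ∃ R : H →L[ℝ] H, R.IsPositive ∧ R.comp R = T then h.choose else 0

/-- `Λ(t) = Q_t^{-1/2} e^{tA}`: `Λ(t) x` is a preimage of `e^{tA} x` under `Q_t^{1/2}`
(the preimage exists if `e^{tA} H ⊆ Q_t^{1/2} H` and is unique if `Q_t^{1/2}` is injective). -/
def Lam (S : ℝ → H →L[ℝ] H) (Q : H →L[ℝ] H) (t : ℝ) (x : H) : H :=
  Function.invFun (opSqrt (covOp S Q t)) (S t x)

/-- The space `C_b^1(H)` of bounded Fréchet differentiable functions with bounded derivative. -/
def IsCb1 (f : H → ℝ) : Prop :=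
  Differentiable ℝ f ∧ (∃ M : ℝ, ∀ x, |f x| ≤ M) ∧ ∃ M : ℝ, ∀ x, ‖gradient f x‖ ≤ M

variable [MeasurableSpace H] [BorelSpace H]

open Classical in
/-- The centered Gaussian measure `N_T` on `H` with covariance operator `T`: the unique Gaussian
measure with mean `0` and covariance operator `T` (and `0` if there is none; it exists on a
separable `H` if `T` is nonnegative, self-adjoint and of trace class). -/
def gaussianMeasure (T : H →L[ℝ] H) : Measure H :=
  if h : ∃ μ : Measure H, IsGaussian μ ∧ ∫ y, y ∂μ = 0 ∧ covarianceOperator μ = T then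
    h.choose
  else 0

/-- The transition semigroup `S_t f (x) = 𝔼 f(Z_t^x) = ∫ f(e^{tA} x + y) N_{Q_t}(dy)` of the
solution `Z^x` of `dZ = A Z dt + √Q dW`, `Z_0 = x`. -/
def transition (S : ℝ → H →L[ℝ] H) (Q : H →L[ℝ] H) (t : ℝ) (f : H → ℝ) (x : H) : ℝ :=
  ∫ y, f (S t x + y) ∂(gaussianMeasure (covOp S Q t))

/-- The iterates `u^0(t,x) = S_t u₀ (x)` and
`u^{n+1}(t,x) = S_t u₀ (x) + ∫₀ᵗ S_{t-s} ⟨B, D u^n(s)⟩ (x) ds`. -/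
def iterU (S : ℝ → H →L[ℝ] H) (Q : H →L[ℝ] H) (B : H → H) (u₀ : H → ℝ) : ℕ → ℝ → H → ℝ
  | 0 => fun t x => transition S Q t u₀ x
  | n + 1 => fun t x => transition S Q t u₀ x +
      ∫ s in (0 : ℝ)..t,
        transition S Q (t - s) (fun y => ⟪B y, gradient (iterU S Q B u₀ n s) y⟫) x

/-- `v^0 = u^0` and `v^{n+1} = u^{n+1} - u^n`. -/
def iterV (S : ℝ → H →L[ℝ] H) (Q : H →L[ℝ] H) (B : H → H) (u₀ : H → ℝ) : ℕ → ℝ → H → ℝ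
  | 0 => fun t x => iterU S Q B u₀ 0 t x
  | n + 1 => fun t x => iterU S Q B u₀ (n + 1) t x - iterU S Q B u₀ n t x

/-- The iteration is well posed: for `t > 0` the iterates `u^n(t)` lie in `C_b^1(H)`,
`⟨B, D u^n(t)⟩` is a bounded measurable function, and all the time integrals in the
iteration are those of integrable functions. -/
structure IterationWellPosed (S : ℝ → H →L[ℝ] H) (Q : H →L[ℝ] H) (B : H → H) (u₀ : H → ℝ) :
    Prop where
  isCb1 : ∀ (n : ℕ) (t : ℝ), 0 < t → IsCb1 (iterU S Q B u₀ n t)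
  measurable : ∀ (n : ℕ) (t : ℝ), 0 < t →
    Measurable (fun y => ⟪B y, gradient (iterU S Q B u₀ n t) y⟫)
  bounded : ∀ (n : ℕ) (t : ℝ), 0 < t →
    ∃ M : ℝ, ∀ y, |⟪B y, gradient (iterU S Q B u₀ n t) y⟫| ≤ M
  integrable : ∀ (n : ℕ) (t : ℝ), 0 < t → ∀ x : H,
    IntervalIntegrable (fun s => transition S Q (t - s)
      (fun y => ⟪B y, gradient (iterU S Q B u₀ n s) y⟫) x) volume 0 t

end

end KolmogorovSeries

namespace KolmogorovSeries

-- The engine is a smoothing estimate: for `f` merely bounded and measurable, `S_t f` is Fréchet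
-- differentiable with `‖D S_t f‖ ≤ ‖f‖_∞ C t^{-δ}`. To get it, `N_{Q_t}` is realized as the law of
-- a random vector `X` with `⟪y, X⟫ = W (√Q_t y)`, where `W` is an isonormal process. By
-- Cameron-Martin, translating `X` by `√Q_t k` amounts to inserting the density `exp (W k -
-- ‖k‖²/2)`. Since `e^{tA} = √Q_t L` with `L` linear and `‖L‖ ≤ C t^{-δ}`, moving `x` by `h` moves
-- only this density, with `k = L h`; expanding it to first order gives the derivative `h ↦ 𝔼[W (L
-- h) f]` (`IsIsonormal.hasFDerivAt_integral`, `IsC0Semigroup.hasFDerivAt_transition`).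
--
-- The terms `w⁰ = S_t u₀`, `wⁿ⁺¹ = ∫₀ᵗ S_{t-s} ⟨B, Dwⁿ(s)⟩ ds` are then estimated by induction:
-- differentiating under the integral bounds `Dwⁿ(t)` by `a_n t^{-δ+n(1-δ)}`, each step contributing
-- a beta integral (`IsSmoothing.hasFDerivAt_duhamel`, `IsSmoothing.hasGradBound_picard`). The beta
-- integrals tend to `0`, so `∑ a_n rⁿ` converges for every `r > 0`
-- (`summable_picardConst_mul_pow`), and the Weierstrass test gives both uniform limits. The
-- singular factor `t^{-δ}` is why the gradients are considered only for `t ≥ t₀ > 0`.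
--
-- The `wⁿ` are constructed independently of the iterates; afterwards linearity gives `uⁿ = w⁰ + ⋯ +
-- wⁿ` (`IterationData.iterU_eq_sum`), hence `vⁿ = wⁿ`. Joint measurability comes from continuity in
-- `t` of the characteristic functions of `N_{Q_t}` and from difference quotients.

universe u

/-! ### Square roots of positive operators on a real Hilbert space. -/

section SquareRoot

variable {H : Type*} [NormedAddCommGroup H] [InnerProductSpace ℝ H] [CompleteSpace H]

/-- The scalar majorant of the iteration `Y ↦ (A + Y²) / 2` for `1 - √(1 - A)`. -/
noncomputable def sqrtIter (a : ℝ) : ℕ → ℝ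
  | 0 => 0
  | n + 1 => (a + sqrtIter a n ^ 2) / 2

/-- The iteration `Y ↦ (A + Y²) / 2`, whose limit is `1 - √(1 - A)`. -/
noncomputable def opSqrtIter (A : H →L[ℝ] H) : ℕ → H →L[ℝ] H
  | 0 => 0
  | n + 1 => (2⁻¹ : ℝ) • (A + opSqrtIter A n * opSqrtIter A n)

lemma sqrtIter_mem (n : ℕ) : 0 ≤ sqrtIter 1 n ∧ sqrtIter 1 n ≤ 1 := by
  induction n with
  | zero => simp [sqrtIter]
  | succ n ih => simp only [sqrtIter]; constructor <;> nlinarith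

lemma norm_opSqrtIter_le {A : H →L[ℝ] H} (hA : ‖A‖ ≤ 1) (n : ℕ) :
    ‖opSqrtIter A n‖ ≤ sqrtIter 1 n := by
  induction n with
  | zero => simp [opSqrtIter, sqrtIter]
  | succ n ih =>
    have h1 : ‖opSqrtIter A n * opSqrtIter A n‖ ≤ sqrtIter 1 n ^ 2 := by
      refine (norm_mul_le _ _).trans ?_
      nlinarith [norm_nonneg (opSqrtIter A n)]
    simp only [opSqrtIter, sqrtIter, norm_smul]
    have := norm_add_le A (opSqrtIter A n * opSqrtIter A n)
    norm_num
    linarith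

lemma norm_opSqrtIter_succ_sub_le {A : H →L[ℝ] H} (hA : ‖A‖ ≤ 1) (n : ℕ) :
    ‖opSqrtIter A (n + 1) - opSqrtIter A n‖ ≤ sqrtIter 1 (n + 1) - sqrtIter 1 n := by
  induction n with
  | zero =>
    simp only [opSqrtIter, sqrtIter, norm_smul, mul_zero, add_zero, sub_zero]
    norm_num
    exact hA
  | succ n ih =>
    set Y := opSqrtIter A n
    set Z := opSqrtIter A (n + 1)
    have h : opSqrtIter A (n + 1 + 1) - Z
        = (2⁻¹ : ℝ) • (Z * (Z - Y) + (Z - Y) * Y) := by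
      have e1 : opSqrtIter A (n + 1 + 1) = (2⁻¹ : ℝ) • (A + Z * Z) := rfl
      have e2 : Z = (2⁻¹ : ℝ) • (A + Y * Y) := rfl
      calc opSqrtIter A (n + 1 + 1) - Z
          = (2⁻¹ : ℝ) • (A + Z * Z) - (2⁻¹ : ℝ) • (A + Y * Y) := by rw [e1, ← e2]
        _ = _ := by
          rw [← smul_sub]
          congr 1
          noncomm_ring
    have hY := norm_opSqrtIter_le hA n
    have hZ := norm_opSqrtIter_le hA (n + 1)
    have h1 : ‖Z * (Z - Y)‖ ≤ sqrtIter 1 (n + 1) * (sqrtIter 1 (n + 1) - sqrtIter 1 n) :=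
      (norm_mul_le _ _).trans (mul_le_mul hZ ih (norm_nonneg _) ((norm_nonneg _).trans hZ))
    have h2 : ‖(Z - Y) * Y‖ ≤ (sqrtIter 1 (n + 1) - sqrtIter 1 n) * sqrtIter 1 n :=
      (norm_mul_le _ _).trans (mul_le_mul ih hY (norm_nonneg _) ((norm_nonneg _).trans ih))
    have e3 : sqrtIter 1 (n + 1 + 1) - sqrtIter 1 (n + 1)
        = 2⁻¹ * (sqrtIter 1 (n + 1) * (sqrtIter 1 (n + 1) - sqrtIter 1 n)
          + (sqrtIter 1 (n + 1) - sqrtIter 1 n) * sqrtIter 1 n) := by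
      have e1 : sqrtIter 1 (n + 1 + 1) = (1 + sqrtIter 1 (n + 1) ^ 2) / 2 := rfl
      have e2 : sqrtIter 1 (n + 1) = (1 + sqrtIter 1 n ^ 2) / 2 := rfl
      rw [e1]
      nlinarith
    rw [h, e3, norm_smul]
    have := norm_add_le (Z * (Z - Y)) ((Z - Y) * Y)
    norm_num
    linarith

lemma isSelfAdjoint_opSqrtIter {A : H →L[ℝ] H} (hA : IsSelfAdjoint A) (n : ℕ) :
    IsSelfAdjoint (opSqrtIter A n) := by
  induction n with
  | zero => exact IsSelfAdjoint.zero _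
  | succ n ih =>
    have h : IsSelfAdjoint (opSqrtIter A n * opSqrtIter A n) := by
      rw [isSelfAdjoint_iff, star_mul, ih.star_eq]
    exact (IsSelfAdjoint.all (2⁻¹ : ℝ)).smul (hA.add h)

/-- The increments are dominated by those of the scalar iteration, whose sum telescopes and stays
below `1`. -/
lemma exists_opSqrtIter_limit {A : H →L[ℝ] H} (hA : ‖A‖ ≤ 1) :
    ∃ Y, Tendsto (opSqrtIter A) atTop (𝓝 Y) := by
  apply cauchySeq_tendsto_of_complete
  refine cauchySeq_of_dist_le_of_summable (fun n => sqrtIter 1 (n + 1) - sqrtIter 1 n) (fun n => ?_) ?_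
  · rw [dist_comm, dist_eq_norm]
    exact norm_opSqrtIter_succ_sub_le hA n
  · refine summable_of_sum_range_le (c := 1) (fun n => ?_) (fun n => ?_)
    · exact (norm_nonneg _).trans (norm_opSqrtIter_succ_sub_le hA n)
    · rw [Finset.sum_range_sub]
      simpa [sqrtIter] using (sqrtIter_mem n).2

/-- A positive contraction has a positive square root. -/
lemma exists_sqrt_of_norm_le_one {T : H →L[ℝ] H} (hT : T.IsPositive) (h1 : ‖T‖ ≤ 1) :
    ∃ R : H →L[ℝ] H, R.IsPositive ∧ R.comp R = T := by
  have hsa : IsSelfAdjoint (1 - T) := (IsSelfAdjoint.one _).sub hT.isSelfAdjoint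
  have hA : ‖1 - T‖ ≤ 1 := by
    have hsym := hT.isSelfAdjoint
    -- Positivity of `T` tested at `x - T x`, combined with `‖T‖ ≤ 1`.
    have hTx : ∀ x, ‖T x‖ ^ 2 ≤ ⟪T x, x⟫ := by
      intro x
      have h2 : ∀ c : ℝ, 0 ≤ ⟪T (x - c • T x), x - c • T x⟫ := fun c => hT.inner_nonneg_left _
      have h3 := h2 1
      have h4 : ⟪T (T x), x⟫ = ‖T x‖ ^ 2 := by
        rw [hT.inner_left_eq_inner_right (T x) x, real_inner_self_eq_norm_sq]
      have h5 : ⟪T (T x), T x⟫ ≤ ‖T x‖ ^ 2 := by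
        refine (real_inner_le_norm _ _).trans ?_
        have := T.le_of_opNorm_le h1 (T x)
        nlinarith [norm_nonneg (T x)]
      simp only [one_smul, map_sub, inner_sub_left, inner_sub_right, h4,
        real_inner_self_eq_norm_sq] at h3
      linarith
    refine ContinuousLinearMap.opNorm_le_bound _ zero_le_one fun x => ?_
    rw [one_mul]
    refine le_of_sq_le_sq ?_ (norm_nonneg _)
    simp only [sub_apply, one_apply_eq_self]
    rw [norm_sub_sq_real, real_inner_comm]
    nlinarith [hTx x, hT.inner_nonneg_left x]
  obtain ⟨Y, hY⟩ := exists_opSqrtIter_limit hA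
  have hYsa : IsSelfAdjoint Y :=
    isClosed_eq continuous_star continuous_id |>.mem_of_tendsto hY
      (Eventually.of_forall fun n => isSelfAdjoint_opSqrtIter hsa n)
  have hY1 : ‖Y‖ ≤ 1 := le_of_tendsto hY.norm
    (Eventually.of_forall fun n => (norm_opSqrtIter_le hA n).trans (sqrtIter_mem n).2)
  have hfix : Y = (2⁻¹ : ℝ) • ((1 - T) + Y * Y) :=
    tendsto_nhds_unique (hY.comp (tendsto_add_atTop_nat 1))
      (((tendsto_const_nhds (x := 1 - T)).add (hY.mul hY)).const_smul (2⁻¹ : ℝ))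
  -- The fixed point equation `2Y = (1 - T) + Y²` is `(1 - Y)² = T` rearranged; `1 - Y` is positive
  -- because `‖Y‖ ≤ 1`.
  refine ⟨1 - Y, ?_, ?_⟩
  · rw [ContinuousLinearMap.isPositive_iff']
    refine ⟨(IsSelfAdjoint.one _).sub hYsa, fun x => ?_⟩
    have h := Y.le_of_opNorm_le hY1 x
    simp only [sub_apply, one_apply_eq_self, inner_sub_left,
      real_inner_self_eq_norm_sq]
    nlinarith [real_inner_le_norm (Y x) x, norm_nonneg x]
  · change (1 - Y) * (1 - Y) = T
    have h2 : (2 : ℝ) • Y = (1 - T) + Y * Y := by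
      conv_lhs => rw [hfix]
      rw [smul_smul]; norm_num
    have h3 : (1 - Y) * (1 - Y) = 1 - (2 : ℝ) • Y + Y * Y := by
      rw [two_smul]; noncomm_ring
    rw [h3, h2]; abel

/-- A positive bounded operator on a real Hilbert space has a positive square root. -/
lemma exists_sqrt {T : H →L[ℝ] H} (hT : T.IsPositive) :
    ∃ R : H →L[ℝ] H, R.IsPositive ∧ R.comp R = T := by
  -- The added `1` keeps the scaling factor invertible when `T = 0`.
  set c : ℝ := ‖T‖ + 1
  have hc : 0 < c := by positivity
  obtain ⟨R, hR, hRR⟩ := exists_sqrt_of_norm_le_one (T := c⁻¹ • T)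
    (hT.smul_of_nonneg (c := c⁻¹) (by positivity)) (by
      rw [norm_smul, Real.norm_of_nonneg (by positivity), inv_mul_le_iff₀ hc]
      simp [c])
  refine ⟨√c • R, hR.smul_of_nonneg (by positivity), ?_⟩
  have : (√c • R).comp (√c • R) = (√c * √c) • R.comp R := by
    ext x; simp [smul_smul]
  rw [this, hRR, Real.mul_self_sqrt hc.le, smul_smul, mul_inv_cancel₀ hc.ne', one_smul]

lemma opSqrt_spec {T : H →L[ℝ] H} (hT : T.IsPositive) :
    (opSqrt T).IsPositive ∧ (opSqrt T).comp (opSqrt T) = T := by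
  have h := exists_sqrt hT
  rw [opSqrt, dif_pos h]
  exact h.choose_spec

end SquareRoot

/-! ### Linear factorization through an operator that may have a kernel. -/

section Lifting

variable {H : Type*} [NormedAddCommGroup H] [InnerProductSpace ℝ H] [CompleteSpace H]

/-- A map `Λ` with `R (Λ x) = S x` and `‖Λ x‖ ≤ c ‖x‖` can be replaced by a bounded linear operator:
compose it with the orthogonal projection onto `(ker R)ᗮ`. -/
lemma exists_linear_lift (R S : H →L[ℝ] H) (Λ : H → H) (c : ℝ) (hc : 0 ≤ c)
    (h : ∀ x, R (Λ x) = S x) (hΛ : ∀ x, ‖Λ x‖ ≤ c * ‖x‖) :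
    ∃ L : H →L[ℝ] H, R.comp L = S ∧ ‖L‖ ≤ c := by
  set K : Submodule ℝ H := (LinearMap.ker (R : H →ₗ[ℝ] H))ᗮ
  have hkerc : IsClosed ((LinearMap.ker (R : H →ₗ[ℝ] H) : Submodule ℝ H) : Set H) :=
    ContinuousLinearMap.isClosed_ker R
  have : CompleteSpace (LinearMap.ker (R : H →ₗ[ℝ] H)) := hkerc.completeSpace_coe
  have hRp : ∀ x, R (K.starProjection x) = R x := by
    intro x
    have h1 : x - K.starProjection x ∈ Kᗮ := Submodule.sub_starProjection_mem_orthogonal x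
    have h2 : Kᗮ = LinearMap.ker (R : H →ₗ[ℝ] H) := Submodule.orthogonal_orthogonal _
    rw [h2] at h1
    have h3 : R (x - K.starProjection x) = 0 := h1
    rw [map_sub, sub_eq_zero] at h3
    exact h3.symm
  have hinj : ∀ x ∈ K, R x = 0 → x = 0 := by
    intro x hx hRx
    have h1 : x ∈ LinearMap.ker (R : H →ₗ[ℝ] H) := hRx
    exact inner_self_eq_zero.mp (hx x h1)
  -- `R` is injective on `K`, so the projected preimages depend linearly on `x` however the original
  -- preimages were chosen.
  have huniq : ∀ x ∈ K, ∀ y ∈ K, R x = R y → x = y := fun x hx y hy hxy =>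
    sub_eq_zero.mp (hinj _ (K.sub_mem hx hy) (by rw [map_sub, hxy, sub_self]))
  have hmem : ∀ x, K.starProjection x ∈ K := fun x => Submodule.starProjection_apply_mem _ _
  let L₀ : H →ₗ[ℝ] H :=
    { toFun := fun x => K.starProjection (Λ x)
      map_add' := fun x y => huniq _ (hmem _) _ (K.add_mem (hmem _) (hmem _)) (by
        simp only [map_add, hRp, h])
      map_smul' := fun a x => huniq _ (hmem _) _ (K.smul_mem _ (hmem _)) (by
        simp only [map_smul, hRp, h, RingHom.id_apply]) }
  have hb : ∀ x, ‖L₀ x‖ ≤ c * ‖x‖ := fun x =>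
    (Submodule.norm_starProjection_apply_le K (Λ x)).trans (hΛ x)
  refine ⟨L₀.mkContinuous c hb, ?_, LinearMap.mkContinuous_norm_le _ hc _⟩
  ext x
  exact (hRp _).trans (h x)

end Lifting

/-! ### Measurability through countably many coordinates. -/

section Coordinates

variable {H : Type*} [NormedAddCommGroup H] [InnerProductSpace ℝ H]

/-- The coordinates of a vector along a dense sequence. -/
noncomputable def denseCoord (H : Type*) [NormedAddCommGroup H] [InnerProductSpace ℝ H]
    [SecondCountableTopology H] (x : H) (i : ℕ) : ℝ :=
  ⟪TopologicalSpace.denseSeq H i, x⟫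

variable [SecondCountableTopology H]

lemma continuous_denseCoord : Continuous (denseCoord H) :=
  continuous_pi fun _ => by unfold denseCoord; fun_prop

lemma injective_denseCoord : Function.Injective (denseCoord H) := by
  intro x y hxy
  rw [← sub_eq_zero]
  refine (TopologicalSpace.denseRange_denseSeq H).eq_zero_of_inner_left ℝ ?_
  intro i
  have := congrFun hxy i
  simp only [denseCoord] at this
  rw [real_inner_comm, inner_sub_right, this, sub_self]

variable [CompleteSpace H] [MeasurableSpace H] [BorelSpace H]

/-- Lusin-Souslin: a continuous injection out of a Polish space maps Borel sets to Borel sets. -/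
lemma measurableEmbedding_denseCoord : MeasurableEmbedding (denseCoord H) :=
  continuous_denseCoord.measurableEmbedding injective_denseCoord

/-- Weakly measurable functions into a separable Hilbert space are measurable. -/
lemma measurable_of_inner {α : Type*} [MeasurableSpace α] {φ : α → H}
    (h : ∀ y, Measurable fun a => ⟪y, φ a⟫) : Measurable φ := by
  rw [← measurableEmbedding_denseCoord.measurable_comp_iff]
  exact measurable_pi_lambda _ fun i => h _

end Coordinates

/-! ### Local boundedness and strong continuity of the semigroup. -/

section Semigroup

variable {H : Type*} [NormedAddCommGroup H] [InnerProductSpace ℝ H] [CompleteSpace H]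
variable {S : ℝ → H →L[ℝ] H}

lemma IsC0Semigroup.tendsto_nhdsGE (hS : IsC0Semigroup S) (x : H) :
    Tendsto (fun t => S t x) (𝓝[≥] 0) (𝓝 x) := by
  have h : ContinuousWithinAt (fun t => S t x) (Set.Ioi 0) 0 := by
    have := hS.tendsto_zero x
    simpa [ContinuousWithinAt, hS.map_zero] using this
  have h2 := continuousWithinAt_Ioi_iff_Ici.mp h
  simpa [ContinuousWithinAt, hS.map_zero] using h2

/-- Otherwise `‖S (τ n)‖ > n` along some `τ n → 0`, although each orbit `S (τ n) x` converges; this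
contradicts Banach-Steinhaus. -/
lemma IsC0Semigroup.exists_bound_near_zero (hS : IsC0Semigroup S) :
    ∃ η > 0, ∃ M, ∀ t, 0 ≤ t → t ≤ η → ‖S t‖ ≤ M := by
  by_contra! hcon
  choose τ h0 h1 hτ using fun n : ℕ => hcon (1 / ((n : ℝ) + 1)) Nat.one_div_pos_of_nat n
  have hlim : Tendsto τ atTop (𝓝[≥] 0) := by
    refine tendsto_nhdsWithin_iff.mpr ⟨?_, Eventually.of_forall h0⟩
    exact squeeze_zero h0 h1 tendsto_one_div_add_atTop_nhds_zero_nat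
  obtain ⟨M, hM⟩ := banach_steinhaus (g := fun n => S (τ n)) fun x => by
    obtain ⟨C, hC⟩ := ((hS.tendsto_nhdsGE x).comp hlim).norm.bddAbove_range
    exact ⟨C, fun n => hC ⟨n, rfl⟩⟩
  obtain ⟨n, hn⟩ := exists_nat_gt M
  exact absurd (hM n) (not_le.mpr (hn.trans (hτ n)))

lemma IsC0Semigroup.exists_bound (hS : IsC0Semigroup S) (T : ℝ) :
    ∃ M, ∀ t, 0 ≤ t → t ≤ T → ‖S t‖ ≤ M := by
  obtain ⟨η, hη, M, hM⟩ := hS.exists_bound_near_zero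
  have key : ∀ n : ℕ, ∃ M', ∀ t, 0 ≤ t → t ≤ n * η → ‖S t‖ ≤ M' := by
    intro n
    induction n with
    | zero =>
      refine ⟨M, fun t h0 h1 => hM t h0 ?_⟩
      simp only [Nat.cast_zero, zero_mul] at h1
      linarith
    | succ n ih =>
      obtain ⟨M', hM'⟩ := ih
      refine ⟨max M' (M' * M), fun t h0 h1 => ?_⟩
      rcases le_total t (n * η) with h | h
      · exact (hM' t h0 h).trans (le_max_left _ _)
      · have hn : 0 ≤ (n : ℝ) * η := by positivity
        have e : S t = (S (n * η)).comp (S (t - n * η)) := by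
          rw [← hS.map_add _ _ hn (by linarith)]; congr 1; ring
        rw [e]
        refine (ContinuousLinearMap.opNorm_comp_le _ _).trans (le_max_of_le_right ?_)
        refine mul_le_mul (hM' _ hn le_rfl) (hM _ (by linarith) ?_) (norm_nonneg _)
          ((norm_nonneg _).trans (hM' _ hn le_rfl))
        push_cast at h1
        linarith
  obtain ⟨n, hn⟩ := exists_nat_gt (T / η)
  obtain ⟨M', hM'⟩ := key n
  exact ⟨M', fun t h0 h1 => hM' t h0 (h1.trans ((div_lt_iff₀ hη).mp hn).le)⟩

/-- The semigroup extended by the identity to negative times. -/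
def posExt (S : ℝ → H →L[ℝ] H) (t : ℝ) : H →L[ℝ] H := S (max t 0)

lemma posExt_of_nonneg {t : ℝ} (ht : 0 ≤ t) : posExt S t = S t := by
  rw [posExt, max_eq_left ht]

lemma IsC0Semigroup.continuous_posExt (hS : IsC0Semigroup S) (x : H) :
    Continuous fun t => posExt S t x := by
  have hcont : ContinuousOn (fun t => S t x) (Set.Ici 0) := by
    intro t₀ ht₀
    have ht₀ : 0 ≤ t₀ := ht₀
    obtain ⟨M, hM⟩ := hS.exists_bound (t₀ + 1)
    -- Factoring out the earlier time reduces left and right continuity at `t₀` alike to right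
    -- continuity at `0`.
    have hest : ∀ a b, 0 ≤ a → a ≤ t₀ + 1 → a ≤ b → ‖S b x - S a x‖ ≤ M * ‖S (b - a) x - x‖ := by
      intro a b h0 h1 hab
      have e : S b x = S a (S (b - a) x) := by
        rw [← ContinuousLinearMap.comp_apply, ← hS.map_add _ _ h0 (by linarith)]
        congr 2; ring
      rw [e, ← map_sub]
      exact (S a).le_of_opNorm_le (hM a h0 h1) _
    have habs : Tendsto (fun t => |t - t₀|) (𝓝[≥] t₀ ⊔ 𝓝[Set.Ici 0] t₀) (𝓝[≥] 0) := by
      refine tendsto_nhdsWithin_iff.mpr ⟨?_, Eventually.of_forall fun t => Set.mem_Ici.mpr (abs_nonneg _)⟩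
      have : Tendsto (fun t => |t - t₀|) (𝓝 t₀) (𝓝 0) := by
        have : Continuous fun t : ℝ => |t - t₀| := by fun_prop
        simpa using this.tendsto t₀
      exact this.mono_left (sup_le inf_le_left inf_le_left)
    have hlim := (((hS.tendsto_nhdsGE x).comp (habs.mono_left le_sup_right)).sub_const x).norm.const_mul M
    simp only [sub_self, norm_zero, mul_zero, Function.comp_def] at hlim
    refine tendsto_iff_norm_sub_tendsto_zero.mpr (squeeze_zero' ?_ ?_ hlim)
    · exact Eventually.of_forall fun _ => norm_nonneg _
    · have h1 : ∀ᶠ t in 𝓝[Set.Ici 0] t₀, t < t₀ + 1 :=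
        (nhdsWithin_le_nhds : 𝓝[Set.Ici 0] t₀ ≤ 𝓝 t₀) (Iio_mem_nhds (by linarith))
      filter_upwards [h1, self_mem_nhdsWithin] with t ht1 ht0
      rcases le_total t₀ t with h | h
      · rw [abs_of_nonneg (by linarith)]
        exact hest t₀ t ht₀ (by linarith) h
      · rw [abs_of_nonpos (by linarith), neg_sub, norm_sub_rev]
        exact hest t t₀ ht0 ht1.le h
  exact hcont.comp_continuous (by fun_prop) fun t => Set.mem_Ici.mpr (le_max_right _ _)

lemma IsC0Semigroup.exists_bound_posExt (hS : IsC0Semigroup S) (T : ℝ) :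
    ∃ M, ∀ t, t ≤ T → ‖posExt S t‖ ≤ M := by
  obtain ⟨M, hM⟩ := hS.exists_bound (max T 0)
  exact ⟨M, fun t ht => hM _ (le_max_right _ _) (max_le_max ht le_rfl)⟩

variable [SecondCountableTopology H] [MeasurableSpace H] [BorelSpace H]

lemma IsC0Semigroup.measurable_posExt (hS : IsC0Semigroup S) :
    Measurable fun p : ℝ × H => posExt S p.1 p.2 :=
  measurable_uncurry_of_continuous_of_measurable (u := fun t x => posExt S t x)
    hS.continuous_posExt fun t => (posExt S t).measurable

end Semigroup

/-! ### The covariance operators `Q_t`. -/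

section Covariance

variable {H : Type*} [NormedAddCommGroup H] [InnerProductSpace ℝ H] [CompleteSpace H]
  [SecondCountableTopology H] [MeasurableSpace H] [BorelSpace H]
variable {S : ℝ → H →L[ℝ] H}

/-- The integrand `e^{sA} Q e^{sA*} x` of the covariance operator. -/
noncomputable def covIntegrand (S : ℝ → H →L[ℝ] H) (Q : H →L[ℝ] H) (s : ℝ) (x : H) : H :=
  posExt S s (Q (ContinuousLinearMap.adjoint (posExt S s) x))

/-- Strong continuity of the semigroup immediately gives weak continuity of the adjoint orbits, and
on a separable space this suffices for measurability. -/
lemma IsC0Semigroup.measurable_covIntegrand (hS : IsC0Semigroup S) (Q : H →L[ℝ] H) (x : H) :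
    Measurable fun s => covIntegrand S Q s x := by
  have h1 : Measurable fun s => ContinuousLinearMap.adjoint (posExt S s) x := by
    refine measurable_of_inner fun y => ?_
    simp only [ContinuousLinearMap.adjoint_inner_right]
    exact ((hS.continuous_posExt y).inner continuous_const).measurable
  exact hS.measurable_posExt.comp (measurable_id.prodMk (Q.measurable.comp h1))

lemma IsC0Semigroup.exists_norm_covIntegrand_le (hS : IsC0Semigroup S) (Q : H →L[ℝ] H) (T : ℝ) :
    ∃ K, 0 ≤ K ∧ ∀ s, s ≤ T → ∀ x, ‖covIntegrand S Q s x‖ ≤ K * ‖x‖ := by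
  obtain ⟨M, hM⟩ := hS.exists_bound_posExt T
  have hM0 : 0 ≤ M := (norm_nonneg _).trans (hM T le_rfl)
  refine ⟨M * (‖Q‖ * M), by positivity, fun s hs x => ?_⟩
  have h1 : ‖ContinuousLinearMap.adjoint (posExt S s) x‖ ≤ M * ‖x‖ :=
    (ContinuousLinearMap.adjoint (posExt S s)).le_of_opNorm_le
      (((ContinuousLinearMap.adjoint : (H →L[ℝ] H) ≃ₗᵢ⋆[ℝ] (H →L[ℝ] H)).norm_map _).trans_le
        (hM s hs)) x
  calc ‖covIntegrand S Q s x‖ ≤ M * ‖Q (ContinuousLinearMap.adjoint (posExt S s) x)‖ :=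
        (posExt S s).le_of_opNorm_le (hM s hs) _
    _ ≤ M * (‖Q‖ * (M * ‖x‖)) := by
        gcongr
        exact (Q.le_opNorm _).trans (by gcongr)
    _ = M * (‖Q‖ * M) * ‖x‖ := by ring

lemma IsC0Semigroup.intervalIntegrable_covIntegrand (hS : IsC0Semigroup S) (Q : H →L[ℝ] H) (x : H)
    (a b : ℝ) : IntervalIntegrable (fun s => covIntegrand S Q s x) volume a b := by
  obtain ⟨K, hK0, hK⟩ := hS.exists_norm_covIntegrand_le Q (max a b)
  refine (intervalIntegrable_const (c := K * ‖x‖)).mono_fun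
    (hS.measurable_covIntegrand Q x).aestronglyMeasurable ?_
  refine (ae_restrict_iff' measurableSet_uIoc).mpr (Eventually.of_forall fun s hs => ?_)
  exact (hK s hs.2 x).trans (le_abs_self _)

/-- The bound on the integrand makes the strong integral a bounded operator, which rules out the
default value in `covOp`. -/
lemma IsC0Semigroup.covOp_apply (hS : IsC0Semigroup S) (Q : H →L[ℝ] H) {t : ℝ} (ht : 0 ≤ t) (x : H) :
    covOp S Q t x = ∫ s in (0 : ℝ)..t, covIntegrand S Q s x := by
  have hcongr : ∀ x, ∫ s in (0 : ℝ)..t, S s (Q (ContinuousLinearMap.adjoint (S s) x))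
      = ∫ s in (0 : ℝ)..t, covIntegrand S Q s x := fun x => by
    refine intervalIntegral.integral_congr fun s hs => ?_
    rw [Set.uIcc_of_le ht] at hs
    simp only [covIntegrand, posExt_of_nonneg hs.1]
  obtain ⟨K, hK0, hK⟩ := hS.exists_norm_covIntegrand_le Q t
  have hex : ∃ T : H →L[ℝ] H, ∀ x : H,
      T x = ∫ s in (0 : ℝ)..t, S s (Q (ContinuousLinearMap.adjoint (S s) x)) := by
    simp only [hcongr]
    let T₀ : H →ₗ[ℝ] H :=
      { toFun := fun x => ∫ s in (0 : ℝ)..t, covIntegrand S Q s x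
        map_add' := fun x y => by
          rw [← intervalIntegral.integral_add (hS.intervalIntegrable_covIntegrand Q x _ _)
            (hS.intervalIntegrable_covIntegrand Q y _ _)]
          simp only [covIntegrand, _root_.map_add]
        map_smul' := fun a x => by
          rw [RingHom.id_apply, ← intervalIntegral.integral_smul]
          simp only [covIntegrand, map_smul] }
    refine ⟨T₀.mkContinuous (K * |t - 0|) fun x => ?_, fun x => rfl⟩
    refine (intervalIntegral.norm_integral_le_of_norm_le_const (C := K * ‖x‖) fun s hs => ?_).trans
      (by linarith)
    rw [Set.uIoc_of_le ht] at hs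
    exact hK s hs.2 x
  rw [covOp, dif_pos hex, hex.choose_spec x, hcongr]

lemma IsC0Semigroup.inner_covOp (hS : IsC0Semigroup S) (Q : H →L[ℝ] H) {t : ℝ} (ht : 0 ≤ t)
    (x y : H) :
    ⟪y, covOp S Q t x⟫ = ∫ s in (0 : ℝ)..t, ⟪y, covIntegrand S Q s x⟫ := by
  rw [hS.covOp_apply Q ht]
  exact ((innerSL ℝ y).intervalIntegral_comp_comm
    (hS.intervalIntegrable_covIntegrand Q x 0 t)).symm

lemma inner_covIntegrand (Q : H →L[ℝ] H) (s : ℝ) (x y : H) :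
    ⟪y, covIntegrand S Q s x⟫ = ⟪ContinuousLinearMap.adjoint (posExt S s) y,
      Q (ContinuousLinearMap.adjoint (posExt S s) x)⟫ := by
  rw [covIntegrand, ContinuousLinearMap.adjoint_inner_left]

lemma IsC0Semigroup.isPositive_covOp (hS : IsC0Semigroup S) {Q : H →L[ℝ] H} (hQ : Q.IsPositive)
    {t : ℝ} (ht : 0 ≤ t) : (covOp S Q t).IsPositive := by
  rw [ContinuousLinearMap.isPositive_iff]
  refine ⟨fun x y => ?_, fun x => ?_⟩
  · change ⟪covOp S Q t x, y⟫ = ⟪x, covOp S Q t y⟫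
    rw [real_inner_comm, hS.inner_covOp Q ht, hS.inner_covOp Q ht]
    simp only [inner_covIntegrand]
    refine intervalIntegral.integral_congr fun s _ => ?_
    rw [← hQ.inner_left_eq_inner_right, real_inner_comm]
  · rw [real_inner_comm, hS.inner_covOp Q ht]
    refine intervalIntegral.integral_nonneg ht fun s _ => ?_
    rw [inner_covIntegrand]
    exact hQ.inner_nonneg_right _

lemma IsC0Semigroup.continuous_inner_covOp (hS : IsC0Semigroup S) (Q : H →L[ℝ] H) (x : H) :
    Continuous fun t => ⟪x, covOp S Q (max t 0) x⟫ := by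
  have h : Continuous fun t => ∫ s in (0 : ℝ)..t, covIntegrand S Q s x :=
    intervalIntegral.continuous_primitive (hS.intervalIntegrable_covIntegrand Q x) 0
  have h2 : ∀ t : ℝ, covOp S Q (max t 0) x = ∫ s in (0 : ℝ)..(max t 0), covIntegrand S Q s x :=
    fun t => hS.covOp_apply Q (le_max_right _ _) x
  simp only [h2]
  exact continuous_const.inner (h.comp (by fun_prop))

lemma IsC0Semigroup.covOp_zero (hS : IsC0Semigroup S) (Q : H →L[ℝ] H) : covOp S Q 0 = 0 := by
  ext x
  simp [hS.covOp_apply Q le_rfl]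

end Covariance

/-! ### Isonormal Gaussian processes and their exponential tilts. -/

section Isonormal

variable {H : Type*} [NormedAddCommGroup H] [InnerProductSpace ℝ H]
variable {Ω : Type*} [MeasurableSpace Ω] {P : Measure Ω}

/-- The linear isometry `W : H → L²(P)` is an isonormal Gaussian process: `W k ∼ N(0, ‖k‖²)`. -/
def IsIsonormal (W : H →ₗᵢ[ℝ] Lp ℝ 2 P) : Prop :=
  ∀ k, ∫ ω, Complex.exp (W k ω * Complex.I) ∂P = Complex.exp (-(‖k‖ ^ 2 / 2 : ℝ))

lemma integrable_exp_mul_I [IsFiniteMeasure P] {f : Ω → ℝ} (hf : AEStronglyMeasurable f P) :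
    Integrable (fun ω => Complex.exp (f ω * Complex.I)) P := by
  refine Integrable.of_bound (C := 1) ?_ (Eventually.of_forall fun ω => ?_)
  · exact (by fun_prop : Continuous fun x : ℝ => Complex.exp (x * Complex.I)).comp_aestronglyMeasurable hf
  · rw [Complex.norm_exp_ofReal_mul_I]

/-- The characteristic functional is continuous on `L²`. -/
lemma continuous_integral_exp_mul_I [IsProbabilityMeasure P] :
    Continuous fun F : Lp ℝ 2 P => ∫ ω, Complex.exp (F ω * Complex.I) ∂P := by
  have hlip : ∀ a b : ℝ, ‖Complex.exp (a * Complex.I) - Complex.exp (b * Complex.I)‖ ≤ |a - b| := by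
    intro a b
    have h := Real.norm_exp_I_mul_ofReal_sub_one_le (x := a - b)
    have e : Complex.exp (a * Complex.I) - Complex.exp (b * Complex.I)
        = Complex.exp (b * Complex.I) * (Complex.exp (Complex.I * ((a - b : ℝ) : ℂ)) - 1) := by
      rw [mul_sub, ← Complex.exp_add, mul_one]
      congr 2
      push_cast
      ring
    rw [e, norm_mul, Complex.norm_exp_ofReal_mul_I, one_mul]
    exact h
  refine (LipschitzWith.of_dist_le_mul (K := 1) fun F G => ?_).continuous
  rw [NNReal.coe_one, one_mul, dist_eq_norm, dist_eq_norm,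
    ← integral_sub (integrable_exp_mul_I (Lp.aestronglyMeasurable F))
      (integrable_exp_mul_I (Lp.aestronglyMeasurable G))]
  have hmem : MemLp (F - G : Lp ℝ 2 P) 2 P := Lp.memLp _
  calc ‖∫ ω, (Complex.exp (F ω * Complex.I) - Complex.exp (G ω * Complex.I)) ∂P‖
      ≤ ∫ ω, ‖(F - G : Lp ℝ 2 P) ω‖ ∂P := by
        refine norm_integral_le_of_norm_le (hmem.integrable one_le_two).norm ?_
        filter_upwards [Lp.coeFn_sub F G] with ω hω
        rw [hω]
        exact hlip _ _
    _ = (eLpNorm (F - G : Lp ℝ 2 P) 1 P).toReal := by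
        rw [integral_norm_eq_lintegral_enorm hmem.aestronglyMeasurable, eLpNorm_one_eq_lintegral_enorm]
    _ ≤ ‖F - G‖ := by
        rw [Lp.norm_def]
        refine ENNReal.toReal_mono (Lp.eLpNorm_ne_top _) ?_
        exact eLpNorm_le_eLpNorm_of_exponent_le one_le_two (Lp.aestronglyMeasurable _)

lemma integral_exp_mul_I_sum_infinitePi {ι : Type*} (c : ι → ℝ) (s : Finset ι) :
    ∫ ω, Complex.exp ((∑ i ∈ s, c i * ω i : ℝ) * Complex.I)
      ∂(Measure.infinitePi fun _ : ι => gaussianReal 0 1)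
      = Complex.exp (-((∑ i ∈ s, c i ^ 2) / 2 : ℝ)) := by
  set P := Measure.infinitePi fun _ : ι => gaussianReal 0 1
  have hev : ∀ i, Measurable fun ω : ι → ℝ => ω i := fun i => measurable_pi_apply i
  have hind : iIndepFun (fun i (ω : ι → ℝ) => c i * ω i) P :=
    iIndepFun_infinitePi (P := fun _ : ι => gaussianReal 0 1) (X := fun i x => c i * x)
      (fun i => by fun_prop)
  have h := congrFun (iIndepFun.charFun_map_fun_finsetSum_eq_prod (s := s)
    (X := fun i (ω : ι → ℝ) => c i * ω i) (P := P)
    (fun i _ => ((hev i).const_mul (c i)).aemeasurable)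
    (hind.precomp (g := fun i : s => (i : ι)) Subtype.val_injective)) 1
  rw [charFun_apply_real, integral_map (Finset.measurable_sum _ fun i _ =>
    (hev i).const_mul (c i)).aemeasurable (by fun_prop)] at h
  simp only [Complex.ofReal_one, one_mul] at h
  rw [h, Finset.prod_apply]
  have hfac : ∀ i ∈ s, charFun (P.map fun ω => c i * ω i) 1 = Complex.exp (-(c i ^ 2 / 2 : ℝ)) := by
    intro i _
    rw [charFun_map_mul_comp (hev i).aemeasurable]
    have : P.map (fun ω => ω i) = gaussianReal 0 1 := Measure.infinitePi_map_eval _ i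
    rw [this, charFun_gaussianReal]
    congr 1
    push_cast
    ring
  rw [Finset.prod_congr rfl hfac, ← Complex.exp_sum]
  congr 1
  push_cast
  rw [Finset.sum_neg_distrib, Finset.sum_div]

/-- On a product of standard Gaussians indexed by a Hilbert basis, the coordinates are orthonormal
in `L²`, so sending basis vectors to coordinates extends to an isometry. The characteristic
functional is explicit on finite sums and passes to the limit by continuity on `L²`. -/
lemma exists_isonormal (H : Type u) [NormedAddCommGroup H] [InnerProductSpace ℝ H]
    [CompleteSpace H] :
    ∃ (Ω : Type u) (_ : MeasurableSpace Ω) (P : Measure Ω) (_ : IsProbabilityMeasure P)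
      (W : H →ₗᵢ[ℝ] Lp ℝ 2 P), IsIsonormal W := by
  obtain ⟨w, b, -⟩ := exists_hilbertBasis ℝ H
  set P := Measure.infinitePi fun _ : w => gaussianReal 0 1
  have hmap : ∀ i, P.map (fun ω => ω i) = gaussianReal 0 1 := fun i => Measure.infinitePi_map_eval _ i
  have hev : ∀ i, Measurable fun ω : w → ℝ => ω i := fun i => measurable_pi_apply i
  have hmem : ∀ i : w, MemLp (fun ω : w → ℝ => ω i) 2 P := fun i => by
    have := memLp_id_gaussianReal (μ := 0) (v := 1) 2
    rw [← hmap i, memLp_map_measure_iff (by fun_prop) (hev i).aemeasurable] at this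
    exact this
  let ξ : w → Lp ℝ 2 P := fun i => (hmem i).toLp
  have hξ : ∀ i, ξ i =ᵐ[P] fun ω => ω i := fun i => (hmem i).coeFn_toLp
  have hind : iIndepFun (fun i (ω : w → ℝ) => ω i) P :=
    iIndepFun_infinitePi (P := fun _ : w => gaussianReal 0 1) (X := fun i x => x)
      (fun i => by fun_prop)
  have hmean : ∀ i, ∫ ω, ω i ∂P = 0 := fun i => by
    have := integral_id_gaussianReal (μ := 0) (v := 1)
    rw [← hmap i, integral_map (hev i).aemeasurable (by fun_prop)] at this
    exact this
  have hinner : ∀ i j, ⟪ξ i, ξ j⟫ = ∫ ω, ω i * ω j ∂P := fun i j => by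
    rw [L2.inner_def]
    refine integral_congr_ae ?_
    filter_upwards [hξ i, hξ j] with ω h1 h2
    rw [h1, h2, real_inner_eq_re_inner, RCLike.inner_apply]
    simp [mul_comm]
  have hon : Orthonormal ℝ ξ := by
    classical
    rw [orthonormal_iff_ite]
    intro i j
    rw [hinner]
    split_ifs with hij
    · subst hij
      have h1 : ∫ ω : w → ℝ, ω i * ω i ∂P = ∫ x : ℝ, x * x ∂(gaussianReal 0 1) := by
        rw [← hmap i, integral_map (hev i).aemeasurable (by fun_prop)]
      have h2 := variance_id_gaussianReal (μ := 0) (v := 1)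
      rw [variance_of_integral_eq_zero (by fun_prop) (by simp [integral_id_gaussianReal])] at h2
      rw [h1]
      simpa [pow_two] using h2
    · have := (hind.indepFun hij).integral_fun_mul_eq_mul_integral
        (hmem i).aestronglyMeasurable (hmem j).aestronglyMeasurable
      rw [this, hmean, zero_mul]
  let W : H →ₗᵢ[ℝ] Lp ℝ 2 P :=
    hon.orthogonalFamily.linearIsometry.comp b.repr.toLinearIsometry
  have hW : ∀ i, W (b i) = ξ i := fun i => by
    classical
    change hon.orthogonalFamily.linearIsometry (b.repr (b i)) = ξ i
    rw [b.repr_self, hon.orthogonalFamily.linearIsometry_apply_single]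
    simp
  refine ⟨w → ℝ, inferInstance, P, inferInstance, W, fun k => ?_⟩
  set c : w → ℝ := fun i => ⟪b i, k⟫
  have hsum : HasSum (fun i => W (c i • b i)) (W k) := by
    have := (b.hasSum_repr k).mapL W.toContinuousLinearMap
    simp only [b.repr_apply_apply] at this
    exact this
  have h1 := (continuous_integral_exp_mul_I.tendsto (W k)).comp hsum
  have hnorm : HasSum (fun i => c i ^ 2) (‖k‖ ^ 2) := by
    have := b.hasSum_inner_mul_inner k k
    rw [real_inner_self_eq_norm_sq] at this
    refine this.congr_fun fun i => ?_
    rw [real_inner_comm, pow_two]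
  have h2 : Tendsto (fun s : Finset w => Complex.exp (-((∑ i ∈ s, c i ^ 2) / 2 : ℝ))) atTop
      (𝓝 (Complex.exp (-(‖k‖ ^ 2 / 2 : ℝ)))) := by
    have : Continuous fun x : ℝ => Complex.exp (-(x / 2 : ℝ)) := by fun_prop
    exact (this.tendsto _).comp hnorm
  refine tendsto_nhds_unique h1 (h2.congr fun s => ?_)
  rw [← integral_exp_mul_I_sum_infinitePi]
  refine integral_congr_ae ?_
  have hall : ∀ᵐ ω ∂P, ∀ i ∈ s, W (c i • b i) ω = c i * ω i := by
    refine (ae_ball_iff s.countable_toSet).mpr fun i _ => ?_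
    rw [map_smul, hW]
    filter_upwards [Lp.coeFn_smul (c i) (ξ i), hξ i] with ω h3 h4
    rw [h3, Pi.smul_apply, h4, smul_eq_mul]
  filter_upwards [hall, Lp.coeFn_finsetSum s fun i => W (c i • b i)] with ω h3 h4
  rw [h4, Finset.sum_apply, Finset.sum_congr rfl h3]

end Isonormal

section IsonormalLaw

variable {H : Type*} [NormedAddCommGroup H] [InnerProductSpace ℝ H]
variable {Ω : Type*} [MeasurableSpace Ω] {P : Measure Ω} {W : H →ₗᵢ[ℝ] Lp ℝ 2 P}

lemma aemeasurable_Lp (F : Lp ℝ 2 P) : AEMeasurable F P :=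
  (Lp.aestronglyMeasurable F).aemeasurable

lemma IsIsonormal.map_eq (hW : IsIsonormal W) [IsProbabilityMeasure P] (k : H) :
    P.map (W k) = gaussianReal 0 (‖k‖₊ ^ 2) := by
  apply Measure.ext_of_charFun
  ext t
  rw [charFun_gaussianReal, charFun_apply_real, integral_map (aemeasurable_Lp _) (by fun_prop)]
  -- `IsIsonormal` prescribes the characteristic function only at `1`; linearity of `W` recovers it
  -- at every `t`.
  have h := hW (t • k)
  rw [norm_smul, Real.norm_eq_abs, mul_pow, sq_abs] at h
  trans ∫ ω, Complex.exp (W (t • k) ω * Complex.I) ∂P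
  · refine integral_congr_ae ?_
    rw [map_smul]
    filter_upwards [Lp.coeFn_smul t (W k)] with ω hω
    rw [hω]
    simp
  · rw [h]
    congr 1
    push_cast
    simp
    ring

lemma IsIsonormal.integrable_exp (hW : IsIsonormal W) [IsProbabilityMeasure P] (k : H) :
    Integrable (fun ω => Real.exp (W k ω)) P := by
  have h := integrable_exp_mul_gaussianReal (μ := 0) (v := ‖k‖₊ ^ 2) 1
  rw [← hW.map_eq, integrable_map_measure (by fun_prop) (aemeasurable_Lp _)] at h
  simpa [Function.comp_def] using h

lemma IsIsonormal.integral_exp (hW : IsIsonormal W) [IsProbabilityMeasure P] (k : H) :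
    ∫ ω, Real.exp (W k ω) ∂P = Real.exp (‖k‖ ^ 2 / 2) := by
  have h := mgf_gaussianReal (hW.map_eq k) 1
  simpa [mgf] using h

lemma IsIsonormal.integral_eq_zero (hW : IsIsonormal W) [IsProbabilityMeasure P] (k : H) :
    ∫ ω, W k ω ∂P = 0 := by
  have h := integral_id_gaussianReal (μ := 0) (v := ‖k‖₊ ^ 2)
  rw [← hW.map_eq, integral_map (aemeasurable_Lp _) (by fun_prop)] at h
  exact h

lemma IsIsonormal.isProbabilityMeasure_tilted (hW : IsIsonormal W) [IsProbabilityMeasure P]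
    (k : H) : IsProbabilityMeasure (P.tilted (W k)) :=
  MeasureTheory.isProbabilityMeasure_tilted (hW.integrable_exp k)

/-- Under the measure tilted by `W k`, the variable `W l` has law `N(⟪l, k⟫, ‖l‖²)`. -/
lemma IsIsonormal.integral_tilted_exp_mul_I (hW : IsIsonormal W) [IsProbabilityMeasure P]
    (k l : H) : ∫ ω, Complex.exp (W l ω * Complex.I) ∂(P.tilted (W k))
      = Complex.exp (⟪l, k⟫ * Complex.I - (‖l‖ ^ 2 / 2 : ℝ)) := by
  have := hW.isProbabilityMeasure_tilted k
  have hmgf : mgf (W l) (P.tilted (W k)) = mgf id (gaussianReal ⟪l, k⟫ (‖l‖₊ ^ 2)) := by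
    ext s
    rw [mgf_id_gaussianReal, mgf, integral_exp_tilted, hW.integral_exp]
    have h1 : ∫ ω, Real.exp ((⇑(W k) + fun ω => s * W l ω) ω) ∂P
        = ∫ ω, Real.exp (W (k + s • l) ω) ∂P := by
      refine integral_congr_ae ?_
      rw [map_add, map_smul]
      filter_upwards [Lp.coeFn_add (W k) (s • W l), Lp.coeFn_smul s (W l)] with ω h2 h3
      rw [h2, Pi.add_apply, Pi.add_apply, h3, Pi.smul_apply, smul_eq_mul]
    rw [h1, hW.integral_exp, ← Real.exp_sub]
    congr 1
    rw [norm_add_sq_real, norm_smul, inner_smul_right, real_inner_comm, mul_pow]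
    simp
    ring
  have hset : integrableExpSet (W l) (P.tilted (W k)) = Set.univ := by
    rw [integrableExpSet_eq_of_mgf hmgf, integrableExpSet_id_gaussianReal]
  -- The moment generating functions agree and are finite on all of `ℝ`, so analytic continuation
  -- allows evaluation at `i`.
  have h := eqOn_complexMGF_of_mgf hmgf (x := Complex.I) (by simp [hset])
  rw [complexMGF_id_gaussianReal] at h
  simp only [complexMGF] at h
  simp only [mul_comm _ Complex.I] at h ⊢
  rw [h]
  congr 1
  simp
  ring

end IsonormalLaw

/-! ### Trace class covariances and the Gaussian measures they define. -/

section TraceClass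

variable {H : Type*} [NormedAddCommGroup H] [InnerProductSpace ℝ H] [CompleteSpace H]

/-- Cauchy-Schwarz and Bessel bound each finite partial trace by `∑ ‖aₖ‖ ‖bₖ‖`. Applied to a
positive `T`, this is what makes `√T` Hilbert-Schmidt. -/
lemma IsTraceClass.summable_inner {T : H →L[ℝ] H} (hT : IsTraceClass T) (hpos : T.IsPositive)
    {ι : Type*} {b : ι → H} (hb : Orthonormal ℝ b) : Summable fun i => ⟪b i, T (b i)⟫ := by
  obtain ⟨u, v, huv, hsum⟩ := hT
  refine summable_of_sum_le (c := ∑' k, ‖u k‖ * ‖v k‖) (fun i => hpos.inner_nonneg_right _)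
    fun s => ?_
  have h1 : ∀ i, HasSum (fun k => ⟪u k, b i⟫ * ⟪b i, v k⟫) ⟪b i, T (b i)⟫ := fun i => by
    have := (hsum (b i)).mapL (innerSL ℝ (b i))
    simpa [inner_smul_right] using this
  have h2 : HasSum (fun k => ∑ i ∈ s, ⟪u k, b i⟫ * ⟪b i, v k⟫) (∑ i ∈ s, ⟪b i, T (b i)⟫) :=
    hasSum_sum fun i _ => h1 i
  refine hasSum_le (fun k => ?_) h2 huv.hasSum
  have hbes : ∀ x : H, √(∑ i ∈ s, ⟪b i, x⟫ ^ 2) ≤ ‖x‖ := fun x => by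
    rw [Real.sqrt_le_left (norm_nonneg _)]
    have := hb.sum_inner_products_le (s := s) x
    simpa using this
  calc ∑ i ∈ s, ⟪u k, b i⟫ * ⟪b i, v k⟫
      = ∑ i ∈ s, ⟪b i, u k⟫ * ⟪b i, v k⟫ := by simp only [real_inner_comm]
    _ ≤ √(∑ i ∈ s, ⟪b i, u k⟫ ^ 2) * √(∑ i ∈ s, ⟪b i, v k⟫ ^ 2) :=
        Real.sum_mul_le_sqrt_mul_sqrt _ _ _
    _ ≤ ‖u k‖ * ‖v k‖ := by gcongr <;> exact hbes _

end TraceClass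

section GaussianMeasure

variable {H : Type*} [NormedAddCommGroup H] [InnerProductSpace ℝ H] [CompleteSpace H]
  [SecondCountableTopology H] [MeasurableSpace H] [BorelSpace H]
variable {Ω : Type*} [MeasurableSpace Ω] {P : Measure Ω} {W : H →ₗᵢ[ℝ] Lp ℝ 2 P}

/-- An isonormal process composed with a Hilbert-Schmidt operator `R` is represented by an
`H`-valued random variable `X`. -/
lemma exists_random_vector (W : H →ₗᵢ[ℝ] Lp ℝ 2 P) (R : H →L[ℝ] H)
    {ι : Type*} (b : HilbertBasis ι ℝ H) (hR : Summable fun i => ‖R (b i)‖ ^ 2) :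
    ∃ X : Ω → H, Measurable X ∧ MemLp X 2 P ∧ ∀ y, (fun ω => ⟪y, X ω⟫) =ᵐ[P] W (R y) := by
  let J : H → Lp ℝ 2 P →L[ℝ] Lp H 2 P := fun h => (ContinuousLinearMap.toSpanSingleton ℝ h).compLpL 2 P
  have hJ : ∀ h F, J h F =ᵐ[P] fun ω => F ω • h := fun h F =>
    ((ContinuousLinearMap.toSpanSingleton ℝ h).coeFn_compLpL F).trans (by simp)
  let f : ι → Lp H 2 P := fun i => J (b i) (W (R (b i)))
  -- The vector is `X = ∑ W (R bᵢ) bᵢ`. Its terms are orthogonal in `L²(P; H)` with norms `‖R bᵢ‖`,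
  -- so the Hilbert-Schmidt condition is exactly convergence.
  have hinner : ∀ i j, ⟪f i, f j⟫ = ⟪R (b i), R (b j)⟫ * ⟪b i, b j⟫ := by
    intro i j
    rw [← W.inner_map_map, L2.inner_def, L2.inner_def, ← integral_mul_const]
    refine integral_congr_ae ?_
    filter_upwards [hJ (b i) (W (R (b i))), hJ (b j) (W (R (b j)))] with ω h1 h2
    simp only [f]
    rw [h1, h2, inner_smul_left, inner_smul_right]
    simp
    ring
  have hnorm : ∀ i, ‖f i‖ ^ 2 = ‖R (b i)‖ ^ 2 := fun i => by
    rw [← real_inner_self_eq_norm_sq, hinner, real_inner_self_eq_norm_sq,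
      real_inner_self_eq_norm_sq, b.orthonormal.1 i]
    simp
  have horth : OrthogonalFamily ℝ (fun i => (ℝ ∙ f i : Submodule ℝ (Lp H 2 P)))
      fun i => (ℝ ∙ f i).subtypeₗᵢ := by
    intro i j hij x y
    obtain ⟨a, ha⟩ := Submodule.mem_span_singleton.mp x.2
    obtain ⟨c, hc⟩ := Submodule.mem_span_singleton.mp y.2
    change ⟪(x : Lp H 2 P), (y : Lp H 2 P)⟫ = 0
    rw [← ha, ← hc, inner_smul_left, inner_smul_right, hinner, b.orthonormal.2 hij]
    simp
  have hsum : Summable f := by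
    have := (horth.summable_iff_norm_sq_summable
      fun i => ⟨f i, Submodule.mem_span_singleton_self _⟩).mpr
    refine this (hR.congr fun i => ?_)
    exact (hnorm i).symm
  set F : Lp H 2 P := ∑' i, f i
  have hF : ∀ y, (innerSL ℝ y).compLpL 2 P F = W (R y) := by
    intro y
    have h1 := hsum.hasSum.mapL ((innerSL ℝ y).compLpL 2 P)
    have h2 : HasSum (fun i => W (R (⟪b i, y⟫ • b i))) (W (R y)) := by
      have := (b.hasSum_repr y).mapL (W.toContinuousLinearMap.comp R)
      simp only [b.repr_apply_apply] at this
      exact this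
    refine h1.unique (h2.congr_fun fun i => ?_)
    rw [map_smul, map_smul]
    apply Lp.ext
    filter_upwards [(innerSL ℝ y).coeFn_compLpL (f i), hJ (b i) (W (R (b i))),
      Lp.coeFn_smul ⟪b i, y⟫ (W (R (b i)))] with ω h3 h4 h5
    rw [h3, h5]
    simp only [f] at h4 ⊢
    rw [h4]
    simp [real_inner_comm, mul_comm]
  refine ⟨F, (Lp.stronglyMeasurable F).measurable, Lp.memLp F, fun y => ?_⟩
  have := (innerSL ℝ y).coeFn_compLpL F
  rw [hF] at this
  exact this.symm

variable {R : H →L[ℝ] H} {X : Ω → H}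

lemma isGaussian_map_of_isonormal [IsProbabilityMeasure P] (hW : IsIsonormal W)
    (hX : Measurable X) (hXW : ∀ y, (fun ω => ⟪y, X ω⟫) =ᵐ[P] W (R y)) :
    IsGaussian (P.map X) := by
  refine isGaussian_of_map_eq_gaussianReal fun L => ?_
  set y := (InnerProductSpace.toDual ℝ H).symm L
  refine ⟨0, ‖R y‖₊ ^ 2, ?_⟩
  rw [Measure.map_map L.measurable hX, ← hW.map_eq]
  refine Measure.map_congr ((hXW y).mono fun ω hω => ?_) |>.trans rfl
  rw [← hω]
  simp [y]

lemma integral_map_of_isonormal [IsProbabilityMeasure P] (hW : IsIsonormal W)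
    (hX : Measurable X) (hX2 : MemLp X 2 P) (hXW : ∀ y, (fun ω => ⟪y, X ω⟫) =ᵐ[P] W (R y)) :
    ∫ y, y ∂(P.map X) = 0 := by
  rw [integral_map hX.aemeasurable (by fun_prop)]
  refine ext_inner_left ℝ fun y => ?_
  rw [← integral_inner (hX2.integrable one_le_two), integral_congr_ae (hXW y),
    hW.integral_eq_zero, inner_zero_right]

lemma covarianceOperator_map_of_isonormal [IsProbabilityMeasure P]
    (hX : Measurable X) (hX2 : MemLp X 2 P) (hR : R.IsPositive)
    (hXW : ∀ y, (fun ω => ⟪y, X ω⟫) =ᵐ[P] W (R y)) :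
    covarianceOperator (P.map X) = R.comp R := by
  have hid : MemLp id 2 (P.map X) := by
    rw [memLp_map_measure_iff (by fun_prop) hX.aemeasurable]
    exact hX2
  refine ContinuousLinearMap.ext fun x => ext_inner_right ℝ fun y => ?_
  rw [covarianceOperator_inner hid, integral_map hX.aemeasurable
    (by fun_prop), ContinuousLinearMap.comp_apply, hR.inner_left_eq_inner_right,
    ← W.inner_map_map, L2.inner_def]
  refine integral_congr_ae ?_
  filter_upwards [hXW x, hXW y] with ω h1 h2
  rw [h1, h2]
  simp [mul_comm]

lemma gaussian_unique {μ ν : Measure H} (hμ : IsGaussian μ) (hν : IsGaussian ν)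
    (hμ0 : ∫ y, y ∂μ = 0) (hν0 : ∫ y, y ∂ν = 0)
    (hcov : covarianceOperator μ = covarianceOperator ν) : μ = ν := by
  refine IsGaussian.ext (by simpa using hμ0.trans hν0.symm) ?_
  ext x y
  have h1 := covarianceOperator_inner (μ := μ) IsGaussian.memLp_two_id x y
  have h2 := covarianceOperator_inner (μ := ν) IsGaussian.memLp_two_id x y
  rw [covarianceBilin_apply IsGaussian.memLp_two_id, covarianceBilin_apply IsGaussian.memLp_two_id]
  simp only [id_eq, hμ0, hν0, sub_zero]
  rw [← h1, ← h2, hcov]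

/-- The law of `X` witnesses existence in the definition of `gaussianMeasure`, and uniqueness
identifies the chosen measure with it. -/
lemma gaussianMeasure_eq_map [IsProbabilityMeasure P] (hW : IsIsonormal W)
    (hX : Measurable X) (hX2 : MemLp X 2 P) (hR : R.IsPositive)
    (hXW : ∀ y, (fun ω => ⟪y, X ω⟫) =ᵐ[P] W (R y)) :
    gaussianMeasure (R.comp R) = P.map X := by
  have hex : ∃ μ : Measure H, IsGaussian μ ∧ ∫ y, y ∂μ = 0 ∧ covarianceOperator μ = R.comp R :=
    ⟨P.map X, isGaussian_map_of_isonormal hW hX hXW, integral_map_of_isonormal hW hX hX2 hXW,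
      covarianceOperator_map_of_isonormal hX hX2 hR hXW⟩
  rw [gaussianMeasure, dif_pos hex]
  obtain ⟨h1, h2, h3⟩ := hex.choose_spec
  exact gaussian_unique h1 (isGaussian_map_of_isonormal hW hX hXW) h2
    (integral_map_of_isonormal hW hX hX2 hXW)
    (h3.trans (covarianceOperator_map_of_isonormal hX hX2 hR hXW).symm)

/-- The Gaussian measure `N_T` of a positive trace class operator `T` is the law of `√T W` for
an isonormal process `W`. -/
lemma exists_gaussian_representation {H : Type u} [NormedAddCommGroup H] [InnerProductSpace ℝ H]
    [CompleteSpace H] [SecondCountableTopology H] [MeasurableSpace H] [BorelSpace H]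
    {T : H →L[ℝ] H} (hT : T.IsPositive) (htr : IsTraceClass T) :
    ∃ (Ω : Type u) (_ : MeasurableSpace Ω) (P : Measure Ω) (_ : IsProbabilityMeasure P)
      (W : H →ₗᵢ[ℝ] Lp ℝ 2 P) (X : Ω → H), IsIsonormal W ∧ Measurable X ∧
      (∀ y, (fun ω => ⟪y, X ω⟫) =ᵐ[P] W (opSqrt T y)) ∧ gaussianMeasure T = P.map X := by
  obtain ⟨Ω, _, P, _, W, hW⟩ := exists_isonormal H
  obtain ⟨w, b, -⟩ := exists_hilbertBasis ℝ H
  obtain ⟨hR, hRR⟩ := opSqrt_spec hT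
  have hsum : Summable fun i => ‖opSqrt T (b i)‖ ^ 2 := by
    refine (htr.summable_inner hT b.orthonormal).congr fun i => ?_
    conv_lhs => rw [← hRR]
    rw [ContinuousLinearMap.comp_apply, ← hR.inner_left_eq_inner_right, real_inner_self_eq_norm_sq]
  obtain ⟨X, hX, hX2, hXW⟩ := exists_random_vector W (opSqrt T) b hsum
  refine ⟨Ω, _, P, inferInstance, W, X, hW, hX, hXW, ?_⟩
  rw [← gaussianMeasure_eq_map hW hX hX2 hR hXW, hRR]

lemma isProbabilityMeasure_gaussianMeasure {T : H →L[ℝ] H} (hT : T.IsPositive)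
    (htr : IsTraceClass T) : IsProbabilityMeasure (gaussianMeasure T) := by
  obtain ⟨Ω, _, P, _, W, X, hW, hX, hXW, h⟩ := exists_gaussian_representation hT htr
  rw [h]
  exact Measure.isProbabilityMeasure_map hX.aemeasurable

lemma charFun_gaussianMeasure {T : H →L[ℝ] H} (hT : T.IsPositive)
    (htr : IsTraceClass T) (y : H) :
    charFun (gaussianMeasure T) y = Complex.exp (-(⟪y, T y⟫ / 2 : ℝ)) := by
  obtain ⟨Ω, _, P, _, W, X, hW, hX, hXW, h⟩ := exists_gaussian_representation hT htr
  obtain ⟨hR, hRR⟩ := opSqrt_spec hT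
  have h2 : ⟪y, T y⟫ = ‖opSqrt T y‖ ^ 2 := by
    conv_lhs => rw [← hRR]
    rw [ContinuousLinearMap.comp_apply, ← hR.inner_left_eq_inner_right, real_inner_self_eq_norm_sq]
  rw [h, charFun_apply, integral_map hX.aemeasurable (by fun_prop), h2, ← hW]
  refine integral_congr_ae ((hXW y).mono fun ω hω => ?_)
  simp only at hω ⊢
  rw [← hω, real_inner_comm]

end GaussianMeasure

/-! ### Cameron-Martin formula and smoothing of bounded measurable functions. -/

section CameronMartin

lemma abs_exp_sub_one_sub_le (a : ℝ) : |Real.exp a - 1 - a| ≤ a ^ 2 * Real.exp |a| := by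
  have h := Complex.norm_exp_sub_sum_le_norm_mul_exp (a : ℂ) 2
  simp only [Finset.sum_range_succ, Finset.sum_range_zero] at h
  norm_num at h
  rw [← Complex.ofReal_exp, ← Complex.ofReal_one, ← Complex.ofReal_add, ← Complex.ofReal_sub,
    Complex.norm_real, Real.norm_eq_abs] at h
  rwa [sub_sub]

/-- Quadratic Taylor remainder of the density in `σ`, with a majorant that is Gaussian integrable
and independent of `σ`. The exponent `3` collects two factors `exp (|z| + 1)` from `a²` and one from
`exp |a|`. -/
lemma abs_exp_gaussian_remainder_le {σ : ℝ} (h0 : 0 ≤ σ) (h1 : σ ≤ 1) (z : ℝ) :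
    |Real.exp (σ * z - σ ^ 2 / 2) - 1 - σ * z|
      ≤ σ ^ 2 * (Real.exp 3 * (Real.exp (3 * z) + Real.exp (-3 * z)) + 1) := by
  set a := σ * z - σ ^ 2 / 2
  have ha : |a| ≤ σ * (|z| + 1) := by
    have e1 : |σ * z| = σ * |z| := by rw [abs_mul, abs_of_nonneg h0]
    have := abs_sub (σ * z) (σ ^ 2 / 2)
    rw [e1, abs_of_nonneg (by positivity : 0 ≤ σ ^ 2 / 2)] at this
    nlinarith
  have ha1 : |a| ≤ |z| + 1 := ha.trans (by nlinarith [abs_nonneg z])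
  have hz : |z| + 1 ≤ Real.exp (|z| + 1) := by linarith [Real.add_one_le_exp (|z| + 1)]
  have hsq : a ^ 2 ≤ σ ^ 2 * Real.exp (|z| + 1) ^ 2 := by
    rw [← sq_abs, ← mul_pow]
    exact pow_le_pow_left₀ (abs_nonneg _) (ha.trans (by gcongr)) 2
  have h3 : a ^ 2 * Real.exp |a| ≤ σ ^ 2 * Real.exp (3 * (|z| + 1)) := by
    calc a ^ 2 * Real.exp |a| ≤ (σ ^ 2 * Real.exp (|z| + 1) ^ 2) * Real.exp (|z| + 1) := by gcongr
      _ = σ ^ 2 * Real.exp (3 * (|z| + 1)) := by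
        rw [← Real.exp_nat_mul, mul_assoc, ← Real.exp_add]; congr 2; push_cast; ring
  have h4 : Real.exp (3 * (|z| + 1)) ≤ Real.exp 3 * (Real.exp (3 * z) + Real.exp (-3 * z)) := by
    rw [mul_add, mul_one, add_comm, Real.exp_add]
    gcongr
    rcases abs_cases z with ⟨h, -⟩ | ⟨h, -⟩ <;> rw [h]
    · linarith [Real.exp_pos (-3 * z)]
    · have : 3 * -z = -3 * z := by ring
      rw [this]
      linarith [Real.exp_pos (3 * z)]
  have h5 := abs_exp_sub_one_sub_le a
  have h6 : Real.exp a - 1 - σ * z = (Real.exp a - 1 - a) - σ ^ 2 / 2 := by simp only [a]; ring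
  rw [h6]
  have h7 := abs_sub (Real.exp a - 1 - a) (σ ^ 2 / 2)
  rw [abs_of_nonneg (by positivity : 0 ≤ σ ^ 2 / 2)] at h7
  nlinarith [sq_nonneg σ]

variable {H : Type*} [NormedAddCommGroup H] [InnerProductSpace ℝ H]
variable {Ω : Type*} [MeasurableSpace Ω] {P : Measure Ω} {W : H →ₗᵢ[ℝ] Lp ℝ 2 P}

/-- The Cameron-Martin density `exp (W k - ‖k‖² / 2)`. -/
noncomputable def cmDensity (W : H →ₗᵢ[ℝ] Lp ℝ 2 P) (k : H) (ω : Ω) : ℝ :=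
  Real.exp (W k ω - ‖k‖ ^ 2 / 2)

lemma IsIsonormal.integrable_cmDensity (hW : IsIsonormal W) [IsProbabilityMeasure P] (k : H) :
    Integrable (cmDensity W k) P := by
  unfold cmDensity
  simp only [Real.exp_sub]
  exact (hW.integrable_exp k).div_const _

lemma integrable_Lp_two [IsProbabilityMeasure P] (F : Lp ℝ 2 P) : Integrable F P :=
  (Lp.memLp F).integrable one_le_two

/-- The variable `W k` has the law of `‖k‖ z` with `z` standard Gaussian, so one constant serves all
`k` in the unit ball. -/
lemma IsIsonormal.exists_remainder_le (hW : IsIsonormal W) [IsProbabilityMeasure P] :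
    ∃ K, 0 ≤ K ∧ ∀ k, ‖k‖ ≤ 1 → ∫ ω, |cmDensity W k ω - 1 - W k ω| ∂P ≤ K * ‖k‖ ^ 2 := by
  set γ := gaussianReal 0 1
  have hint : Integrable (fun z => Real.exp 3 * (Real.exp (3 * z) + Real.exp (-3 * z)) + 1) γ :=
    (((integrable_exp_mul_gaussianReal 3).add (integrable_exp_mul_gaussianReal (-3))).const_mul
      _).add (integrable_const _)
  refine ⟨∫ z, (Real.exp 3 * (Real.exp (3 * z) + Real.exp (-3 * z)) + 1) ∂γ,
    integral_nonneg fun z => by positivity, fun k hk => ?_⟩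
  have hmap : P.map (W k) = γ.map (fun z => ‖k‖ * z) := by
    rw [hW.map_eq, gaussianReal_map_const_mul]
    congr 1
    · simp
    · ext; simp
  have h1 : ∫ ω, |cmDensity W k ω - 1 - W k ω| ∂P
      = ∫ z, |Real.exp (‖k‖ * z - ‖k‖ ^ 2 / 2) - 1 - ‖k‖ * z| ∂γ := by
    have e1 := integral_map (aemeasurable_Lp (W k))
      (f := fun w => |Real.exp (w - ‖k‖ ^ 2 / 2) - 1 - w|) (by fun_prop)
    have e2 := integral_map (μ := γ) (φ := fun z => ‖k‖ * z) (by fun_prop)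
      (f := fun w => |Real.exp (w - ‖k‖ ^ 2 / 2) - 1 - w|) (by fun_prop)
    rw [hmap] at e1
    exact e1.symm.trans e2
  rw [h1, mul_comm, ← integral_const_mul]
  refine integral_mono_of_nonneg (Eventually.of_forall fun z => abs_nonneg _)
    (hint.const_mul _) (Eventually.of_forall fun z => ?_)
  exact abs_exp_gaussian_remainder_le (norm_nonneg k) hk z

variable [CompleteSpace H] [SecondCountableTopology H] [MeasurableSpace H] [BorelSpace H]
variable {R : H →L[ℝ] H} {X : Ω → H}

/-- **Cameron-Martin formula** for the law of `X = R W` and the shift by `R k`. -/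
lemma IsIsonormal.integral_shift (hW : IsIsonormal W) [IsProbabilityMeasure P]
    (hX : Measurable X) (hR : R.IsPositive) (hXW : ∀ y, (fun ω => ⟪y, X ω⟫) =ᵐ[P] W (R y))
    (k : H) {g : H → ℝ} (hg : Measurable g) :
    ∫ ω, g (R k + X ω) ∂P = ∫ ω, cmDensity W k ω * g (X ω) ∂P := by
  have := hW.isProbabilityMeasure_tilted k
  have hmap : (P.tilted (W k)).map X = P.map fun ω => R k + X ω := by
    have hX' : Measurable fun ω => R k + X ω := hX.const_add _
    have := Measure.isProbabilityMeasure_map (μ := P.tilted (W k)) hX.aemeasurable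
    have := Measure.isProbabilityMeasure_map (μ := P) hX'.aemeasurable
    apply Measure.ext_of_charFun
    ext y
    rw [charFun_apply, charFun_apply, integral_map hX.aemeasurable (by fun_prop),
      integral_map hX'.aemeasurable (by fun_prop)]
    have h1 : ∫ ω, Complex.exp (⟪X ω, y⟫ * Complex.I) ∂(P.tilted (W k))
        = ∫ ω, Complex.exp (W (R y) ω * Complex.I) ∂(P.tilted (W k)) := by
      refine integral_congr_ae ((tilted_absolutelyContinuous P _).ae_le
        ((hXW y).mono fun ω hω => ?_))
      simp only at hω ⊢
      rw [← hω, real_inner_comm]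
    have h2 : ∫ ω, Complex.exp (⟪R k + X ω, y⟫ * Complex.I) ∂P
        = ∫ ω, Complex.exp (⟪R k, y⟫ * Complex.I) * Complex.exp (W (R y) ω * Complex.I) ∂P := by
      refine integral_congr_ae ((hXW y).mono fun ω hω => ?_)
      simp only at hω ⊢
      rw [← hω, inner_add_left, real_inner_comm (X ω), ← Complex.exp_add]
      congr 1
      push_cast
      ring
    rw [h1, h2, integral_const_mul, hW, hW.integral_tilted_exp_mul_I, ← Complex.exp_add,
      hR.inner_left_eq_inner_right, hR.inner_left_eq_inner_right k, real_inner_comm]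
    congr 1
    push_cast
    rw [hR.inner_left_eq_inner_right]
    ring
  have h3 : ∫ ω, g (R k + X ω) ∂P = ∫ ω, g (X ω) ∂(P.tilted (W k)) := by
    rw [← integral_map (φ := fun ω => R k + X ω) (hX.const_add _).aemeasurable
      hg.aestronglyMeasurable, ← hmap, integral_map hX.aemeasurable hg.aestronglyMeasurable]
  rw [h3, integral_tilted, hW.integral_exp]
  refine integral_congr_ae (Eventually.of_forall fun ω => ?_)
  simp only [cmDensity, Real.exp_sub, smul_eq_mul]

/-- The smoothing property: if `R L = S` then `x ↦ 𝔼 f (S x + X)` is differentiable for bounded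
measurable `f`, with derivative bounded by `‖f‖_∞ ‖L‖`. -/
lemma IsIsonormal.hasFDerivAt_integral (hW : IsIsonormal W) [IsProbabilityMeasure P]
    (hX : Measurable X) (hR : R.IsPositive) (hXW : ∀ y, (fun ω => ⟪y, X ω⟫) =ᵐ[P] W (R y))
    {S L : H →L[ℝ] H} (hL : R.comp L = S) {f : H → ℝ} (hf : Measurable f) {M : ℝ}
    (hM : ∀ x, |f x| ≤ M) (x : H) :
    ∃ D : H →L[ℝ] ℝ, HasFDerivAt (fun x => ∫ ω, f (S x + X ω) ∂P) D x ∧ ‖D‖ ≤ M * ‖L‖ := by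
  have hM0 : 0 ≤ M := (abs_nonneg _).trans (hM 0)
  have hfm : ∀ x, Measurable fun ω => f (S x + X ω) := fun x => hf.comp (hX.const_add _)
  have hmem : MemLp (fun ω => f (S x + X ω)) 2 P :=
    MemLp.of_bound (hfm x).aestronglyMeasurable M (Eventually.of_forall fun ω => hM _)
  set F : Lp ℝ 2 P := hmem.toLp
  have hF : F =ᵐ[P] fun ω => f (S x + X ω) := hmem.coeFn_toLp
  have hFM : ‖F‖ ≤ M := by
    have := Lp.norm_le_of_ae_bound (f := F) hM0 (hF.mono fun ω hω => by
      rw [hω]; exact hM _)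
    simpa [measureUnivNNReal] using this
  -- The linear part of the density in `k = L h` is `W (L h)`, so the derivative is its `L²` pairing
  -- with `f (S x + X)`. As `W` is an isometry, `‖D‖ ≤ ‖F‖ ‖L‖`.
  let D : H →L[ℝ] ℝ := (innerSL ℝ F).comp (W.toContinuousLinearMap.comp L)
  have hD : ∀ h, D h = ∫ ω, W (L h) ω * f (S x + X ω) ∂P := fun h => by
    change ⟪F, W (L h)⟫ = _
    rw [L2.inner_def]
    refine integral_congr_ae (hF.mono fun ω hω => ?_)
    simp only at hω ⊢
    rw [hω]
    simp
  refine ⟨D, ?_, ?_⟩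
  · obtain ⟨K, hK0, hK⟩ := hW.exists_remainder_le
    have hbdd : ∀ x, ∀ᵐ ω ∂P, ‖f (S x + X ω)‖ ≤ M := fun x => Eventually.of_forall fun ω => hM _
    have hrem : ∀ h, ‖L h‖ ≤ 1 → |(∫ ω, f (S (x + h) + X ω) ∂P) - (∫ ω, f (S x + X ω) ∂P) - D h|
        ≤ M * K * ‖L‖ ^ 2 * ‖h‖ ^ 2 := by
      intro h hh
      -- Since `S h = R (L h)`, the increment moves onto the density and no regularity of `f` is
      -- needed.
      have e1 : ∫ ω, f (S (x + h) + X ω) ∂P = ∫ ω, cmDensity W (L h) ω * f (S x + X ω) ∂P := by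
        rw [← hW.integral_shift hX hR hXW (L h) (g := fun y => f (S x + y))
          (hf.comp (measurable_const_add _))]
        refine integral_congr_ae (Eventually.of_forall fun ω => ?_)
        have : S h = R (L h) := by rw [← hL]; rfl
        simp only [map_add, this, add_assoc]
      have i1 : Integrable (fun ω => cmDensity W (L h) ω * f (S x + X ω)) P :=
        (hW.integrable_cmDensity _).mul_bdd (hfm x).aestronglyMeasurable (hbdd x)
      have i2 : Integrable (fun ω => f (S x + X ω)) P := hmem.integrable one_le_two
      have i3 : Integrable (fun ω => W (L h) ω * f (S x + X ω)) P :=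
        (integrable_Lp_two _).mul_bdd (hfm x).aestronglyMeasurable (hbdd x)
      rw [e1, hD, ← integral_sub i1 i2, 
        ← integral_sub (f := fun ω => cmDensity W (L h) ω * f (S x + X ω) - f (S x + X ω))
          (i1.sub i2) i3, ← Real.norm_eq_abs]
      have hi : Integrable (fun ω => |cmDensity W (L h) ω - 1 - W (L h) ω|) P :=
        (((hW.integrable_cmDensity _).sub (integrable_const 1)).sub (integrable_Lp_two _)).abs
      calc ‖∫ ω, (cmDensity W (L h) ω * f (S x + X ω) - f (S x + X ω)
              - W (L h) ω * f (S x + X ω)) ∂P‖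
          ≤ ∫ ω, |cmDensity W (L h) ω - 1 - W (L h) ω| * M ∂P := by
            refine norm_integral_le_of_norm_le (hi.mul_const M) (Eventually.of_forall fun ω => ?_)
            have : cmDensity W (L h) ω * f (S x + X ω) - f (S x + X ω)
              - W (L h) ω * f (S x + X ω)
              = (cmDensity W (L h) ω - 1 - W (L h) ω) * f (S x + X ω) := by ring
            rw [this, norm_mul, Real.norm_eq_abs]
            gcongr
            exact hM _
        _ ≤ (K * ‖L h‖ ^ 2) * M := by
            rw [integral_mul_const]
            gcongr
            exact hK _ hh
        _ ≤ (K * (‖L‖ * ‖h‖) ^ 2) * M := by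
            gcongr
            exact L.le_opNorm h
        _ = M * K * ‖L‖ ^ 2 * ‖h‖ ^ 2 := by ring
    rw [hasFDerivAt_iff_isLittleO_nhds_zero]
    have hO : (fun h => (∫ ω, f (S (x + h) + X ω) ∂P) - (∫ ω, f (S x + X ω) ∂P) - D h)
        =O[𝓝 0] fun h : H => ‖h‖ ^ 2 := by
      refine Asymptotics.IsBigO.of_bound (M * K * ‖L‖ ^ 2) ?_
      have hev : ∀ᶠ h in 𝓝 (0 : H), ‖L h‖ < 1 := by
        have : Tendsto (fun h => ‖L h‖) (𝓝 0) (𝓝 0) := by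
          have hc : Continuous fun h => ‖L h‖ := by fun_prop
          simpa using hc.tendsto 0
        exact this.eventually_lt_const one_pos
      filter_upwards [hev] with h hh
      rw [norm_pow, norm_norm]
      exact hrem h hh.le
    refine hO.trans_isLittleO ?_
    have := Asymptotics.isLittleO_norm_pow_id (E' := H) (n := 2) (by norm_num)
    exact this
  · calc ‖D‖ ≤ ‖innerSL ℝ F‖ * ‖W.toContinuousLinearMap.comp L‖ :=
          ContinuousLinearMap.opNorm_comp_le _ _
      _ ≤ M * ‖L‖ := by
          gcongr
          · rw [innerSL_apply_norm]; exact hFM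
          · refine ContinuousLinearMap.opNorm_le_bound _ (norm_nonneg _) fun h => ?_
            simpa using L.le_opNorm h

end CameronMartin

/-! ### Measurable dependence of probability measures on time. -/

section MeasurableFamily

/-- A family of probability measures on a Euclidean space with continuous characteristic functions
is measurable. -/
lemma measurable_of_continuous_charFun_finiteDimensional {E : Type*} [NormedAddCommGroup E]
    [InnerProductSpace ℝ E] [FiniteDimensional ℝ E] [MeasurableSpace E] [BorelSpace E]
    {μ : ℝ → Measure E} [∀ t, IsProbabilityMeasure (μ t)]
    (h : ∀ y, Continuous fun t => charFun (μ t) y) : Measurable μ := by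
  let ν : ℝ → ProbabilityMeasure E := fun t => ⟨μ t, inferInstance⟩
  have hν : Continuous ν := by
    refine continuous_iff_seqContinuous.mpr fun u t hu => ?_
    exact ProbabilityMeasure.tendsto_of_tendsto_charFun fun y => ((h y).tendsto t).comp hu
  -- Lévy's theorem gave weak continuity; by the portmanteau theorem the mass of an open set is then
  -- lower semicontinuous in `t`, and open sets generate.
  refine Measurable.measure_of_isPiSystem_of_isProbabilityMeasure
    (S := {s : Set E | IsOpen s}) BorelSpace.measurable_eq isPiSystem_isOpen fun G hG => ?_
  refine LowerSemicontinuous.measurable (lowerSemicontinuous_iff_le_liminf.mpr fun t => ?_)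
  exact ProbabilityMeasure.le_liminf_measure_open_of_tendsto (hν.tendsto t) hG

variable {H : Type*} [NormedAddCommGroup H] [InnerProductSpace ℝ H] [CompleteSpace H]
  [SecondCountableTopology H] [MeasurableSpace H] [BorelSpace H]

/-- A family of probability measures on a separable Hilbert space with continuous characteristic
functions is measurable. -/
lemma measurable_of_continuous_charFun {μ : ℝ → Measure H} [∀ t, IsProbabilityMeasure (μ t)]
    (h : ∀ y, Continuous fun t => charFun (μ t) y) : Measurable μ := by
  -- In infinite dimension, convergence of characteristic functions does not give weak convergence.
  -- The argument is applied to finite dimensional marginals, and cylinders form a generating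
  -- π-system.
  have hcyl : ∀ s ∈ measurableCylinders fun _ : ℕ => ℝ,
      Measurable fun t => (μ t).map (denseCoord H) s := by
    intro s hs
    obtain ⟨I, A, hA, rfl⟩ := (mem_measurableCylinders s).mp hs
    let π : H → EuclideanSpace ℝ I := fun x => WithLp.toLp 2 fun i : I => denseCoord H x i
    have hπ : Measurable π := by
      refine (WithLp.measurable_toLp 2 _).comp (measurable_pi_lambda _ fun i => ?_)
      exact (measurable_pi_apply _).comp continuous_denseCoord.measurable
    have hprob : ∀ t, IsProbabilityMeasure ((μ t).map π) := fun t =>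
      Measure.isProbabilityMeasure_map hπ.aemeasurable
    have hmeas : Measurable fun t => (μ t).map π := by
      refine measurable_of_continuous_charFun_finiteDimensional fun v => ?_
      refine (h (∑ i : I, v i • TopologicalSpace.denseSeq H i)).congr fun t => ?_
      rw [charFun_apply, charFun_apply, integral_map hπ.aemeasurable (by fun_prop)]
      refine integral_congr_ae (Eventually.of_forall fun x => ?_)
      simp only [PiLp.inner_apply, inner_sum, inner_smul_right, π, denseCoord]
      congr 3
      refine Finset.sum_congr rfl fun i _ => ?_
      simp [real_inner_comm, mul_comm]
    have hA' : MeasurableSet {v : EuclideanSpace ℝ I | (fun i => v i) ∈ A} :=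
      hA.preimage (WithLp.measurable_ofLp 2 _)
    have := (Measure.measurable_coe hA').comp hmeas
    convert this using 2 with t
    rw [Function.comp_apply, Measure.map_apply hπ hA',
      Measure.map_apply continuous_denseCoord.measurable hA.cylinder]
    rfl
  have hmap : Measurable fun t => (μ t).map (denseCoord H) := by
    have hprob : ∀ t, IsProbabilityMeasure ((μ t).map (denseCoord H)) := fun t =>
      Measure.isProbabilityMeasure_map continuous_denseCoord.measurable.aemeasurable
    exact Measurable.measure_of_isPiSystem_of_isProbabilityMeasure
      generateFrom_measurableCylinders.symm isPiSystem_measurableCylinders hcyl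
  refine Measure.measurable_of_measurable_coe _ fun s hs => ?_
  have hs' := (measurableEmbedding_denseCoord (H := H)).measurableSet_image.mpr hs
  have := (Measure.measurable_coe hs').comp hmap
  simp only [Function.comp_def, (measurableEmbedding_denseCoord (H := H)).map_apply,
    Set.preimage_image_eq _ injective_denseCoord] at this
  exact this

end MeasurableFamily

/-! ### Smoothing property of the transition semigroup. -/

section Transition

variable {H : Type*} [NormedAddCommGroup H] [InnerProductSpace ℝ H] [CompleteSpace H]
  [SecondCountableTopology H] [MeasurableSpace H] [BorelSpace H]
variable {S : ℝ → H →L[ℝ] H} {Q : H →L[ℝ] H}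

lemma isTraceClass_zero : IsTraceClass (0 : H →L[ℝ] H) :=
  ⟨0, 0, by simp, fun x => by simp⟩

/-- The law of the noise at time `t`, frozen at time `0` for negative `t`. -/
noncomputable def noiseLaw (S : ℝ → H →L[ℝ] H) (Q : H →L[ℝ] H) (t : ℝ) : Measure H :=
  gaussianMeasure (covOp S Q (max t 0))

lemma IsC0Semigroup.isTraceClass_covOp_max (hS : IsC0Semigroup S)
    (hQtr : ∀ t : ℝ, 0 < t → IsTraceClass (covOp S Q t)) (t : ℝ) :
    IsTraceClass (covOp S Q (max t 0)) := by
  rcases le_or_gt t 0 with h | h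
  · rw [max_eq_right h, hS.covOp_zero]
    exact isTraceClass_zero
  · rw [max_eq_left h.le]
    exact hQtr t h

lemma IsC0Semigroup.isProbabilityMeasure_noiseLaw (hS : IsC0Semigroup S) (hQ : Q.IsPositive)
    (hQtr : ∀ t : ℝ, 0 < t → IsTraceClass (covOp S Q t)) (t : ℝ) :
    IsProbabilityMeasure (noiseLaw S Q t) :=
  isProbabilityMeasure_gaussianMeasure (hS.isPositive_covOp hQ (le_max_right _ _))
    (hS.isTraceClass_covOp_max hQtr t)

lemma IsC0Semigroup.measurable_noiseLaw (hS : IsC0Semigroup S) (hQ : Q.IsPositive)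
    (hQtr : ∀ t : ℝ, 0 < t → IsTraceClass (covOp S Q t)) : Measurable (noiseLaw S Q) := by
  have := hS.isProbabilityMeasure_noiseLaw hQ hQtr
  refine measurable_of_continuous_charFun fun y => ?_
  simp only [noiseLaw, charFun_gaussianMeasure (hS.isPositive_covOp hQ (le_max_right _ _))
    (hS.isTraceClass_covOp_max hQtr _)]
  have := hS.continuous_inner_covOp Q y
  fun_prop

lemma transition_eq {t : ℝ} (ht : 0 ≤ t) (f : H → ℝ) (x : H) :
    transition S Q t f x = ∫ y, f (posExt S t x + y) ∂(noiseLaw S Q t) := by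
  rw [transition, noiseLaw, posExt, max_eq_left ht]

/-- Here the range condition and the bound on `Lam` enter: together they give a linear `L` with
`√Q_t L = e^{tA}` and `‖L‖ ≤ C / t ^ δ`. -/
lemma IsC0Semigroup.hasFDerivAt_transition (hS : IsC0Semigroup S) (hQ : Q.IsPositive)
    (hQtr : ∀ t : ℝ, 0 < t → IsTraceClass (covOp S Q t))
    (hrange : ∀ t : ℝ, 0 < t → Set.range (S t) ⊆ Set.range (opSqrt (covOp S Q t)))
    {δ C : ℝ} (hC : 0 < C)
    (hLam : ∀ t : ℝ, 0 < t → ∀ x : H, ‖Lam S Q t x‖ ≤ C / t ^ δ * ‖x‖)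
    {t : ℝ} (ht : 0 < t) {f : H → ℝ} (hf : Measurable f) {M : ℝ} (hM : ∀ x, |f x| ≤ M) (x : H) :
    ∃ D : H →L[ℝ] ℝ, HasFDerivAt (fun x => ∫ y, f (posExt S t x + y) ∂(noiseLaw S Q t)) D x ∧
      ‖D‖ ≤ M * (C / t ^ δ) := by
  have hpos := hS.isPositive_covOp hQ ht.le
  have hM0 : 0 ≤ M := (abs_nonneg _).trans (hM 0)
  obtain ⟨L, hL, hLC⟩ := exists_linear_lift (opSqrt (covOp S Q t)) (S t) (Lam S Q t) (C / t ^ δ)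
    (by positivity) (fun x => Function.invFun_eq (hrange t ht ⟨x, rfl⟩)) (hLam t ht)
  obtain ⟨Ω, _, P, _, W, X, hW, hX, hXW, hlaw⟩ :=
    exists_gaussian_representation hpos (hQtr t ht)
  obtain ⟨D, hD, hDL⟩ := hW.hasFDerivAt_integral hX (opSqrt_spec hpos).1 hXW hL hf hM x
  refine ⟨D, hD.congr_of_eventuallyEq (Eventually.of_forall fun x => ?_),
    hDL.trans (by gcongr)⟩
  simp only [noiseLaw, posExt, max_eq_left ht.le]
  have hfx : Measurable fun y => f (S t x + y) := hf.comp (measurable_const_add _)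
  rw [hlaw, integral_map hX.aemeasurable hfx.aestronglyMeasurable]

end Transition

/-! ### Beta integrals and the growth of the Picard constants. -/

section Beta

/-- The kernel `(t - s)^{-δ} s^β` of the beta integral. -/
noncomputable def betaKernel (δ β t s : ℝ) : ℝ := (t - s) ^ (-δ) * s ^ β

lemma integrableOn_betaKernel_one {δ β : ℝ} (hδ : δ < 1) (hβ : -1 < β) :
    IntervalIntegrable (betaKernel δ β 1) volume 0 1 := by
  have h := (Complex.betaIntegral_convergent (u := (β + 1 : ℝ)) (v := (1 - δ : ℝ))
    (by simp; linarith) (by simp; linarith)).norm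
  rw [intervalIntegrable_iff_integrableOn_Ioo_of_le zero_le_one] at h ⊢
  refine h.congr_fun (fun s hs => ?_) measurableSet_Ioo
  have h0 : 0 < s := hs.1
  have h1 : 0 < 1 - s := by linarith [hs.2]
  have e : (1 : ℂ) - (s : ℂ) = ((1 - s : ℝ) : ℂ) := by push_cast; ring
  simp only [norm_mul]
  rw [e, Complex.norm_cpow_eq_rpow_re_of_pos h0, Complex.norm_cpow_eq_rpow_re_of_pos h1,
    betaKernel, mul_comm]
  simp

/-- The value `∫₀¹ (1 - s)^{-δ} s^β ds`. -/
noncomputable def betaConst (δ β : ℝ) : ℝ := ∫ s in (0 : ℝ)..1, betaKernel δ β 1 s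

lemma betaKernel_nonneg {δ β t s : ℝ} (hs : 0 ≤ s) (hst : s ≤ t) : 0 ≤ betaKernel δ β t s :=
  mul_nonneg (Real.rpow_nonneg (by linarith) _) (Real.rpow_nonneg hs _)

lemma betaConst_nonneg (δ β : ℝ) : 0 ≤ betaConst δ β :=
  intervalIntegral.integral_nonneg zero_le_one fun _ hs => betaKernel_nonneg hs.1 hs.2

lemma betaKernel_mul {δ β t r : ℝ} (ht : 0 < t) (h0 : 0 ≤ r) (h1 : r ≤ 1) :
    betaKernel δ β t (t * r) = t ^ (β - δ) * betaKernel δ β 1 r := by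
  have e : t - t * r = t * (1 - r) := by ring
  rw [betaKernel, betaKernel, e, Real.mul_rpow ht.le (by linarith), Real.mul_rpow ht.le h0,
    sub_eq_neg_add β, Real.rpow_add ht]
  ring

lemma integrable_betaKernel {δ β t : ℝ} (hδ : δ < 1) (hβ : -1 < β) (ht : 0 < t) :
    IntegrableOn (betaKernel δ β t) (Set.Ioo 0 t) := by
  have h : IntervalIntegrable (fun r => betaKernel δ β t (t * r)) volume 0 1 := by
    refine ((integrableOn_betaKernel_one hδ hβ).const_mul (t ^ (β - δ))).congr fun r hr => ?_
    rw [Set.uIoc_of_le zero_le_one] at hr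
    exact (betaKernel_mul ht hr.1.le hr.2).symm
  have h2 := h.comp_mul_left (c := t⁻¹)
  simp only [zero_div, one_div, inv_inv, mul_inv_cancel_left₀ ht.ne'] at h2
  rwa [intervalIntegrable_iff_integrableOn_Ioo_of_le ht.le] at h2

lemma integral_betaKernel {δ β t : ℝ} (ht : 0 < t) :
    ∫ s in Set.Ioo 0 t, betaKernel δ β t s = t ^ (1 - δ + β) * betaConst δ β := by
  rw [← integral_Ioc_eq_integral_Ioo, ← intervalIntegral.integral_of_le ht.le]
  have h := intervalIntegral.integral_comp_mul_left (a := 0) (b := 1) (betaKernel δ β t) ht.ne'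
  rw [mul_zero, mul_one] at h
  have h2 : ∫ r in (0 : ℝ)..1, betaKernel δ β t (t * r) = t ^ (β - δ) * betaConst δ β := by
    rw [betaConst, ← intervalIntegral.integral_const_mul]
    refine intervalIntegral.integral_congr fun r hr => ?_
    rw [Set.uIcc_of_le zero_le_one] at hr
    exact betaKernel_mul ht hr.1 hr.2
  rw [h2, smul_eq_mul, eq_inv_mul_iff_mul_eq₀ ht.ne'] at h
  rw [← h, ← mul_assoc]
  congr 1
  rw [show 1 - δ + β = 1 + (β - δ) by ring, Real.rpow_add ht, Real.rpow_one]

/-- The time exponent of the `n`-th Picard term. -/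
noncomputable def picardExp (δ : ℝ) (n : ℕ) : ℝ := -δ + n * (1 - δ)

lemma picardExp_gt {δ : ℝ} (hδ : δ < 1) (n : ℕ) : -1 < picardExp δ n := by
  have : 0 ≤ (n : ℝ) * (1 - δ) := mul_nonneg n.cast_nonneg (by linarith)
  unfold picardExp
  linarith

/-- On `(0, 1)` the kernel is a fixed integrable function times `(s^{1-δ})ⁿ`, so dominated
convergence applies and no Gamma function asymptotics are needed. -/
lemma tendsto_betaConst {δ : ℝ} (hδ : δ < 1) :
    Tendsto (fun n => betaConst δ (picardExp δ n)) atTop (𝓝 0) := by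
  have hα : 0 < 1 - δ := by linarith
  have hint := integrableOn_betaKernel_one (β := -δ) hδ (by linarith)
  rw [intervalIntegrable_iff_integrableOn_Ioo_of_le zero_le_one] at hint
  have e : ∀ n, betaConst δ (picardExp δ n) = ∫ s in Set.Ioo (0 : ℝ) 1, betaKernel δ (picardExp δ n) 1 s :=
    fun n => by
      rw [betaConst, intervalIntegral.integral_of_le zero_le_one, integral_Ioc_eq_integral_Ioo]
  simp only [e]
  have hfac : ∀ n : ℕ, ∀ s ∈ Set.Ioo (0 : ℝ) 1, betaKernel δ (picardExp δ n) 1 s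
      = betaKernel δ (-δ) 1 s * (s ^ (1 - δ)) ^ n := fun n s hs => by
    rw [betaKernel, betaKernel, picardExp, Real.rpow_add hs.1, mul_comm (n : ℝ), Real.rpow_mul hs.1.le,
      Real.rpow_natCast, mul_assoc]
  have hs1 : ∀ s ∈ Set.Ioo (0 : ℝ) 1, 0 ≤ s ^ (1 - δ) ∧ s ^ (1 - δ) < 1 := fun s hs =>
    ⟨Real.rpow_nonneg hs.1.le _, Real.rpow_lt_one hs.1.le hs.2 hα⟩
  suffices h : Tendsto (fun n => ∫ s in Set.Ioo (0 : ℝ) 1, betaKernel δ (picardExp δ n) 1 s) atTop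
      (𝓝 (∫ _ in Set.Ioo (0 : ℝ) 1, (0 : ℝ))) by rwa [integral_zero] at h
  refine tendsto_integral_of_dominated_convergence (betaKernel δ (-δ) 1) (fun n => ?_) hint
    (fun n => ?_) ?_
  · have := integrableOn_betaKernel_one hδ (picardExp_gt hδ n)
    rw [intervalIntegrable_iff_integrableOn_Ioo_of_le zero_le_one] at this
    exact this.aestronglyMeasurable
  · refine (ae_restrict_iff' measurableSet_Ioo).mpr (Eventually.of_forall fun s hs => ?_)
    have hk : 0 ≤ betaKernel δ (-δ) 1 s := betaKernel_nonneg hs.1.le hs.2.le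
    have hp := hs1 s hs
    rw [hfac n s hs, norm_mul, Real.norm_of_nonneg hk, Real.norm_of_nonneg (pow_nonneg hp.1 n)]
    exact mul_le_of_le_one_right hk (pow_le_one₀ hp.1 hp.2.le)
  · refine (ae_restrict_iff' measurableSet_Ioo).mpr (Eventually.of_forall fun s hs => ?_)
    have hp := hs1 s hs
    have h := (tendsto_pow_atTop_nhds_zero_of_lt_one hp.1 hp.2).const_mul (betaKernel δ (-δ) 1 s)
    rw [mul_zero] at h
    exact h.congr fun n => (hfac n s hs).symm

/-- The constants in the gradient bounds of the Picard terms. -/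
noncomputable def picardConst (δ K : ℝ) (c₀ : ℝ) : ℕ → ℝ
  | 0 => c₀
  | n + 1 => K * (betaConst δ (picardExp δ n) + 1 / (n + 1)) * picardConst δ K c₀ n

lemma picardConst_pos {δ K c₀ : ℝ} (hK : 0 < K) (hc : 0 < c₀) (n : ℕ) :
    0 < picardConst δ K c₀ n := by
  induction n with
  | zero => exact hc
  | succ n ih =>
    have := betaConst_nonneg δ (picardExp δ n)
    simp only [picardConst]
    positivity

/-- Consecutive terms have ratio `K (betaConst + 1/(n+1)) r → 0`. The extra `1/(n+1)` in
`picardConst` only makes positivity of the constants evident, as the ratio test needs nonzero terms.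
-/
lemma summable_picardConst_mul_pow {δ K c₀ : ℝ} (hδ : δ < 1) (hK : 0 < K) (hc : 0 < c₀) {r : ℝ}
    (hr : 0 < r) : Summable fun n => picardConst δ K c₀ n * r ^ n := by
  have hpos := fun n => picardConst_pos (δ := δ) hK hc n
  refine summable_of_ratio_test_tendsto_lt_one (l := 0) one_pos
    (Eventually.of_forall fun n => (mul_pos (hpos n) (pow_pos hr n)).ne') ?_
  have h := (((tendsto_betaConst hδ).add tendsto_one_div_add_atTop_nhds_zero_nat).const_mul
    K).mul_const r
  simp only [add_zero, mul_zero, zero_mul] at h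
  refine h.congr fun n => ?_
  rw [Real.norm_of_nonneg (mul_pos (hpos _) (pow_pos hr _)).le,
    Real.norm_of_nonneg (mul_pos (hpos _) (pow_pos hr _)).le, picardConst]
  have h1 := (hpos n).ne'
  have h2 := (pow_pos hr n).ne'
  rw [pow_succ]
  field_simp

end Beta

/-! ### Measurability of derivatives in a parameter. -/

section Derivative

variable {H : Type*} [NormedAddCommGroup H] [InnerProductSpace ℝ H] [SecondCountableTopology H]
  [MeasurableSpace H] [BorelSpace H]

/-- Directional derivatives of a jointly measurable family of differentiable functions are jointly
measurable. -/
lemma measurable_indicator_fderiv {α : Type*} [MeasurableSpace α] {u : α → H → ℝ} {A : Set α}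
    (hA : MeasurableSet A) (hu : Measurable fun p : α × H => u p.1 p.2)
    {ξ η : α → H} (hξ : Measurable ξ) (hη : Measurable η)
    (hd : ∀ a ∈ A, DifferentiableAt ℝ (u a) (ξ a)) :
    Measurable (A.indicator fun a => fderiv ℝ (u a) (ξ a) (η a)) := by
  let c : ℕ → ℝ := fun n => (n : ℝ) + 1
  have hc : Tendsto (fun n => ‖c n‖) atTop atTop :=
    tendsto_norm_atTop_atTop.comp (tendsto_atTop_add_const_right _ _ tendsto_natCast_atTop_atTop)
  -- Difference quotients with step `1/(n+1)` are measurable and converge pointwise on `A`; the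
  -- indicator removes the points without differentiability.
  refine measurable_of_tendsto_metrizable
    (f := fun n => A.indicator fun a => c n • (u a (ξ a + (c n)⁻¹ • η a) - u a (ξ a)))
    (fun n => ?_) (tendsto_pi_nhds.mpr fun a => ?_)
  · refine Measurable.indicator ?_ hA
    have h1 : Measurable fun a => u a (ξ a + (c n)⁻¹ • η a) :=
      hu.comp (measurable_id.prodMk (hξ.add (hη.const_smul (c n)⁻¹)))
    have h2 : Measurable fun a => u a (ξ a) := hu.comp (measurable_id.prodMk hξ)
    exact (h1.sub h2).const_mul (c n)
  · by_cases ha : a ∈ A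
    · simp only [Set.indicator_of_mem ha]
      exact (hd a ha).hasFDerivAt.lim _ hc
    · simp only [Set.indicator_of_notMem ha]
      exact tendsto_const_nhds

variable [CompleteSpace H]

/-- Weak measurability suffices for the gradient, as `H` is separable; the Riesz isometry carries
the result to the dual. This is needed to differentiate under the Duhamel integral. -/
lemma aestronglyMeasurable_fderiv {u : ℝ → H → ℝ} {A : Set ℝ}
    (hA : MeasurableSet A) (hu : Measurable fun p : ℝ × H => u p.1 p.2) (x : H)
    (hd : ∀ a ∈ A, DifferentiableAt ℝ (u a) x) :
    AEStronglyMeasurable (fun a => fderiv ℝ (u a) x) (volume.restrict A) := by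
  have hm : Measurable (A.indicator fun a => gradient (u a) x) := by
    refine measurable_of_inner fun y => ?_
    have h := measurable_indicator_fderiv hA hu (measurable_const (a := x))
      (measurable_const (a := y)) hd
    convert h using 2 with a
    by_cases ha : a ∈ A
    · simp only [Set.indicator_of_mem ha]
      rw [real_inner_comm]
      exact InnerProductSpace.toDual_symm_apply
    · simp [Set.indicator_of_notMem ha]
  have h2 := (InnerProductSpace.toDual ℝ H).continuous.comp_aestronglyMeasurable
    (hm.aestronglyMeasurable (μ := volume.restrict A))
  refine h2.congr ((ae_restrict_iff' hA).mpr (Eventually.of_forall fun a ha => ?_))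
  simp only [Set.indicator_of_mem ha]
  exact (InnerProductSpace.toDual ℝ H).apply_symm_apply _

end Derivative

/-! ### Duhamel integrals and Picard terms for an abstract smoothing family. -/

section Picard

variable {H : Type*} [NormedAddCommGroup H] [InnerProductSpace ℝ H] [MeasurableSpace H]

/-- The average `∫ f (φ t x + y) κ_t(dy)`. -/
noncomputable def avg (φ : ℝ → H → H) (κ : ℝ → Measure H) (t : ℝ) (f : H → ℝ) (x : H) : ℝ :=
  ∫ y, f (φ t x + y) ∂(κ t)

/-- The averages along `φ` and `κ` depend measurably on all variables and smooth bounded measurable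
functions, with the gradient bound `C / t ^ δ`. -/
structure IsSmoothing (φ : ℝ → H → H) (κ : ℝ → Measure H) (δ C : ℝ) : Prop where
  measurable_flow : Measurable fun p : ℝ × H => φ p.1 p.2
  isProbabilityMeasure : ∀ t, IsProbabilityMeasure (κ t)
  measurable_law : Measurable κ
  smoothing : ∀ t, 0 < t → ∀ f : H → ℝ, Measurable f → ∀ M, (∀ x, |f x| ≤ M) → ∀ x,
    ∃ D : H →L[ℝ] ℝ, HasFDerivAt (avg φ κ t f) D x ∧ ‖D‖ ≤ M * (C / t ^ δ)

/-- The function `⟨B, Dw(s)⟩`, set to `0` for `s ≤ 0`. -/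
noncomputable def drift (B : H → H) (w : ℝ → H → ℝ) (s : ℝ) (y : H) : ℝ :=
  (Set.Ioi (0 : ℝ)).indicator (fun s => fderiv ℝ (w s) y (B y)) s

/-- The Duhamel integral `∫₀ᵗ P_{t-s} G(s) ds`. -/
noncomputable def duhamel (φ : ℝ → H → H) (κ : ℝ → Measure H) (G : ℝ → H → ℝ) (t : ℝ) (x : H) : ℝ :=
  ∫ s in Set.Ioo 0 t, avg φ κ (t - s) (G s) x

/-- The terms of the Picard series: `w⁰ = P_t u₀` and `wⁿ⁺¹ = ∫₀ᵗ P_{t-s} ⟨B, Dwⁿ(s)⟩ ds`. -/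
noncomputable def picard (φ : ℝ → H → H) (κ : ℝ → Measure H) (B : H → H) (u₀ : H → ℝ) :
    ℕ → ℝ → H → ℝ
  | 0 => fun t x => avg φ κ t u₀ x
  | n + 1 => duhamel φ κ (drift B (picard φ κ B u₀ n))

variable [SecondCountableTopology H] [BorelSpace H]
variable {φ : ℝ → H → H} {κ : ℝ → Measure H} {δ C : ℝ}

lemma IsSmoothing.measurable_avg (h : IsSmoothing φ κ δ C) {α : Type*} [MeasurableSpace α]
    {τ : α → ℝ} {ξ : α → H} {g : α → H → ℝ} (hτ : Measurable τ) (hξ : Measurable ξ)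
    (hg : Measurable fun p : α × H => g p.1 p.2) :
    Measurable fun a => avg φ κ (τ a) (g a) (ξ a) := by
  let K : Kernel α H := ⟨fun a => κ (τ a), h.measurable_law.comp hτ⟩
  have : IsMarkovKernel K := ⟨fun a => h.isProbabilityMeasure _⟩
  have hm : Measurable fun p : α × H => g p.1 (φ (τ p.1) (ξ p.1) + p.2) := by
    refine hg.comp (measurable_fst.prodMk (Measurable.add ?_ measurable_snd))
    exact h.measurable_flow.comp ((hτ.comp measurable_fst).prodMk (hξ.comp measurable_fst))
  exact (hm.stronglyMeasurable.integral_kernel_prod_right' (κ := K)).measurable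

lemma IsSmoothing.abs_avg_le (h : IsSmoothing φ κ δ C) {f : H → ℝ} {M : ℝ}
    (hM : ∀ x, |f x| ≤ M) (t : ℝ) (x : H) : |avg φ κ t f x| ≤ M := by
  have := h.isProbabilityMeasure t
  have h1 := norm_integral_le_of_norm_le_const (μ := κ t) (f := fun y => f (φ t x + y)) (C := M)
    (Eventually.of_forall fun y => hM _)
  simpa [avg] using h1

lemma IsSmoothing.avg_sum (h : IsSmoothing φ κ δ C) {ι : Type*} (s : Finset ι) {f : ι → H → ℝ}
    {M : ι → ℝ} (hf : ∀ i, Measurable (f i)) (hM : ∀ i x, |f i x| ≤ M i) (t : ℝ) (x : H) :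
    avg φ κ t (fun y => ∑ i ∈ s, f i y) x = ∑ i ∈ s, avg φ κ t (f i) x := by
  have := h.isProbabilityMeasure t
  simp only [avg]
  refine integral_finsetSum _ fun i _ => ?_
  exact Integrable.of_bound ((hf i).comp (measurable_const_add _)).aestronglyMeasurable (M i)
    (Eventually.of_forall fun y => hM i _)

lemma integrableOn_rpow_Ioo {β : ℝ} (hβ : -1 < β) (t : ℝ) :
    IntegrableOn (fun s : ℝ => s ^ β) (Set.Ioo 0 t) := by
  rcases le_or_gt t 0 with ht | ht
  · simp [Set.Ioo_eq_empty (not_lt.mpr ht)]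
  · exact (intervalIntegrable_iff_integrableOn_Ioo_of_le ht.le).mp
      (intervalIntegral.intervalIntegrable_rpow' hβ)

section Duhamel

variable (h : IsSmoothing φ κ δ C) {G : ℝ → H → ℝ} (hG : Measurable fun p : ℝ × H => G p.1 p.2)
  {K β : ℝ} (hK : ∀ s y, 0 < s → |G s y| ≤ K * s ^ β) (hβ : -1 < β)

include h hG

lemma IsSmoothing.measurable_avg_sub (t : ℝ) (x : H) :
    Measurable fun s => avg φ κ (t - s) (G s) x :=
  h.measurable_avg (by fun_prop) measurable_const hG

lemma IsSmoothing.measurable_duhamel :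
    Measurable fun p : ℝ × H => duhamel φ κ G p.1 p.2 := by
  have hm : Measurable fun q : (ℝ × H) × ℝ => avg φ κ (q.1.1 - q.2) (G q.2) q.1.2 :=
    h.measurable_avg (by fun_prop) (by fun_prop)
      (hG.comp ((measurable_snd.comp measurable_fst).prodMk measurable_snd))
  have hset : MeasurableSet {q : (ℝ × H) × ℝ | 0 < q.2 ∧ q.2 < q.1.1} :=
    (measurableSet_lt measurable_const measurable_snd).inter
      (measurableSet_lt measurable_snd (measurable_fst.comp measurable_fst))
  have := (hm.indicator hset).stronglyMeasurable.integral_prod_right' (ν := (volume : Measure ℝ))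
  convert this.measurable using 2 with p
  -- The moving domain `(0, t)` becomes the indicator of a measurable set of triples, so
  -- measurability of parameter integrals applies.
  rw [duhamel, ← integral_indicator measurableSet_Ioo]
  rfl

include hK hβ

lemma IsSmoothing.integrableOn_avg_sub (t : ℝ) (x : H) :
    IntegrableOn (fun s => avg φ κ (t - s) (G s) x) (Set.Ioo 0 t) := by
  refine Integrable.mono' ((integrableOn_rpow_Ioo hβ t).const_mul K)
    (h.measurable_avg_sub hG t x).aestronglyMeasurable ?_
  refine (ae_restrict_iff' measurableSet_Ioo).mpr (Eventually.of_forall fun s hs => ?_)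
  exact h.abs_avg_le (fun y => hK s y hs.1) _ _

lemma IsSmoothing.abs_duhamel_le {t : ℝ} (ht : 0 < t) (x : H) :
    |duhamel φ κ G t x| ≤ K * (t ^ (β + 1) / (β + 1)) := by
  have hint : ∫ s in Set.Ioo 0 t, K * s ^ β = K * (t ^ (β + 1) / (β + 1)) := by
    rw [integral_const_mul, ← integral_Ioc_eq_integral_Ioo, ← intervalIntegral.integral_of_le ht.le,
      integral_rpow (Or.inl hβ), Real.zero_rpow (by linarith), sub_zero]
  rw [← hint, ← Real.norm_eq_abs, duhamel]
  refine norm_integral_le_of_norm_le ((integrableOn_rpow_Ioo hβ t).const_mul K) ?_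
  refine (ae_restrict_iff' measurableSet_Ioo).mpr (Eventually.of_forall fun s hs => ?_)
  exact h.abs_avg_le (fun y => hK s y hs.1) _ _

/-- Smoothing over the remaining time `t - s` bounds the derivative of the integrand by `K C (t -
s)^{-δ} s^β` uniformly in space. This is integrable since `δ < 1` and `β > -1`, so one may
differentiate under the integral. -/
lemma IsSmoothing.hasFDerivAt_duhamel [CompleteSpace H] (hδ : δ < 1) {t : ℝ} (ht : 0 < t) (x : H) :
    ∃ D : H →L[ℝ] ℝ, HasFDerivAt (duhamel φ κ G t) D x ∧
      ‖D‖ ≤ K * C * (t ^ (1 - δ + β) * betaConst δ β) := by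
  have hsm : ∀ s ∈ Set.Ioo 0 t, ∀ z, HasFDerivAt (avg φ κ (t - s) (G s))
      (fderiv ℝ (avg φ κ (t - s) (G s)) z) z ∧
      ‖fderiv ℝ (avg φ κ (t - s) (G s)) z‖ ≤ K * C * betaKernel δ β t s := by
    intro s hs z
    have hts : 0 < t - s := by linarith [hs.2]
    obtain ⟨D, hD, hDn⟩ := h.smoothing (t - s) hts (G s)
      (hG.comp (measurable_const.prodMk measurable_id)) _ (fun y => hK s y hs.1) z
    rw [hD.fderiv]
    refine ⟨hD, hDn.trans_eq ?_⟩
    rw [betaKernel, Real.rpow_neg hts.le]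
    ring
  have hm : Measurable fun p : ℝ × H => avg φ κ (t - p.1) (G p.1) p.2 :=
    h.measurable_avg (by fun_prop) (by fun_prop)
      (hG.comp ((measurable_fst.comp measurable_fst).prodMk measurable_snd))
  have hint : Integrable (fun s => K * C * betaKernel δ β t s) (volume.restrict (Set.Ioo 0 t)) :=
    (integrable_betaKernel hδ hβ ht).const_mul _
  refine ⟨∫ s in Set.Ioo 0 t, fderiv ℝ (avg φ κ (t - s) (G s)) x, ?_, ?_⟩
  · refine hasFDerivAt_integral_of_dominated_of_fderiv_le (s := Set.univ) univ_mem
      (F := fun z s => avg φ κ (t - s) (G s) z)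
      (F' := fun z s => fderiv ℝ (avg φ κ (t - s) (G s)) z) ?_ ?_ ?_ ?_ hint ?_
    · exact Eventually.of_forall fun z => (h.measurable_avg_sub hG t z).aestronglyMeasurable
    · exact h.integrableOn_avg_sub hG hK hβ t x
    · exact aestronglyMeasurable_fderiv measurableSet_Ioo hm x
        fun s hs => (hsm s hs x).1.differentiableAt
    · exact (ae_restrict_iff' measurableSet_Ioo).mpr
        (Eventually.of_forall fun s hs z _ => (hsm s hs z).2)
    · exact (ae_restrict_iff' measurableSet_Ioo).mpr
        (Eventually.of_forall fun s hs z _ => (hsm s hs z).1)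
  · rw [← integral_betaKernel ht, ← integral_const_mul]
    exact norm_integral_le_of_norm_le hint ((ae_restrict_iff' measurableSet_Ioo).mpr
      (Eventually.of_forall fun s hs => (hsm s hs x).2))

end Duhamel

section Estimates

variable {B : H → H} {u₀ : H → ℝ} {b M : ℝ}

/-- The regularity of a time dependent function carried through the Picard iteration: joint
measurability, and differentiability in space with gradient bound `a t ^ β`. -/
structure HasGradBound (w : ℝ → H → ℝ) (a β : ℝ) : Prop where
  measurable : Measurable fun p : ℝ × H => w p.1 p.2
  differentiable : ∀ t, 0 < t → Differentiable ℝ (w t)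
  norm_fderiv_le : ∀ t, 0 < t → ∀ x, ‖fderiv ℝ (w t) x‖ ≤ a * t ^ β

lemma HasGradBound.measurable_drift {w : ℝ → H → ℝ} {a β : ℝ} (hw : HasGradBound w a β)
    (hB : Measurable B) : Measurable fun p : ℝ × H => drift B w p.1 p.2 := by
  have hu : Measurable fun q : (ℝ × H) × H => w q.1.1 q.2 :=
    hw.measurable.comp ((measurable_fst.comp measurable_fst).prodMk measurable_snd)
  have := measurable_indicator_fderiv (u := fun p : ℝ × H => w p.1)
    (A := {p : ℝ × H | 0 < p.1}) (measurableSet_lt measurable_const measurable_fst) hu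
    measurable_snd (hB.comp measurable_snd) fun p hp => hw.differentiable p.1 hp p.2
  exact this

lemma HasGradBound.abs_drift_le {w : ℝ → H → ℝ} {a β : ℝ} (hw : HasGradBound w a β)
    (hb : ∀ x, ‖B x‖ ≤ b) {s : ℝ} (y : H) (hs : 0 < s) : |drift B w s y| ≤ b * a * s ^ β := by
  rw [drift, Set.indicator_of_mem (Set.mem_Ioi.mpr hs), ← Real.norm_eq_abs]
  have h1 := hw.norm_fderiv_le s hs y
  calc ‖fderiv ℝ (w s) y (B y)‖ ≤ ‖fderiv ℝ (w s) y‖ * ‖B y‖ := ContinuousLinearMap.le_opNorm _ _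
    _ ≤ a * s ^ β * b := mul_le_mul h1 (hb y) (norm_nonneg _) ((norm_nonneg _).trans h1)
    _ = b * a * s ^ β := by ring

lemma IsSmoothing.hasGradBound_picard [CompleteSpace H] (h : IsSmoothing φ κ δ C) (hδ : δ < 1)
    (hC : 0 < C) (hB : Measurable B) (hb0 : 0 < b) (hb : ∀ x, ‖B x‖ ≤ b) (hu : Measurable u₀)
    (hM0 : 0 < M) (hM : ∀ x, |u₀ x| ≤ M) (n : ℕ) :
    HasGradBound (picard φ κ B u₀ n) (picardConst δ (b * C) (M * C) n) (picardExp δ n) := by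
  induction n with
  | zero =>
    have hD := fun t ht x => h.smoothing t ht u₀ hu M hM x
    refine ⟨h.measurable_avg measurable_fst measurable_snd (hu.comp measurable_snd),
      fun t ht x => ?_, fun t ht x => ?_⟩
    · obtain ⟨D, hD, -⟩ := hD t ht x
      exact hD.differentiableAt
    · obtain ⟨D, hD, hDn⟩ := hD t ht x
      have : fderiv ℝ (picard φ κ B u₀ 0 t) x = D := hD.fderiv
      rw [this]
      refine hDn.trans_eq ?_
      simp only [picardConst, picardExp, Nat.cast_zero, zero_mul, add_zero]
      rw [Real.rpow_neg ht.le]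
      ring
  | succ n ih =>
    set a := picardConst δ (b * C) (M * C) n
    have ha : 0 < a := picardConst_pos (by positivity) (by positivity) n
    have hGm := ih.measurable_drift hB
    have hGb : ∀ s y, 0 < s → |drift B (picard φ κ B u₀ n) s y| ≤ b * a * s ^ picardExp δ n :=
      fun s y hs => ih.abs_drift_le hb y hs
    have hD := fun t (ht : 0 < t) x =>
      h.hasFDerivAt_duhamel hGm hGb (picardExp_gt hδ n) hδ ht x
    refine ⟨h.measurable_duhamel hGm, fun t ht x => ?_, fun t ht x => ?_⟩
    · obtain ⟨D, hD, -⟩ := hD t ht x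
      exact hD.differentiableAt
    · obtain ⟨D, hD, hDn⟩ := hD t ht x
      have : fderiv ℝ (picard φ κ B u₀ (n + 1) t) x = D := hD.fderiv
      rw [this]
      refine hDn.trans ?_
      -- Each Duhamel step gains `1 - δ` in the time exponent.
      have e : 1 - δ + picardExp δ n = picardExp δ (n + 1) := by
        simp only [picardExp]; push_cast; ring
      have h1 : (0 : ℝ) < 1 / (n + 1) := by positivity
      have h2 : 0 ≤ t ^ picardExp δ (n + 1) := Real.rpow_nonneg ht.le _
      rw [e, picardConst]
      have h3 : b * a * C * (t ^ picardExp δ (n + 1) * betaConst δ (picardExp δ n))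
          = b * C * betaConst δ (picardExp δ n) * a * t ^ picardExp δ (n + 1) := by ring
      rw [h3]
      gcongr
      linarith

lemma IsSmoothing.abs_picard_succ_le [CompleteSpace H] (h : IsSmoothing φ κ δ C) (hδ : δ < 1)
    (hC : 0 < C) (hB : Measurable B) (hb0 : 0 < b) (hb : ∀ x, ‖B x‖ ≤ b) (hu : Measurable u₀)
    (hM0 : 0 < M) (hM : ∀ x, |u₀ x| ≤ M) (n : ℕ) {t : ℝ} (ht : 0 < t) (x : H) :
    |picard φ κ B u₀ (n + 1) t x| ≤
      b * picardConst δ (b * C) (M * C) n * (t ^ ((n + 1) * (1 - δ)) / (1 - δ)) := by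
  have hw := h.hasGradBound_picard hδ hC hB hb0 hb hu hM0 hM n
  have ha : 0 < picardConst δ (b * C) (M * C) n :=
    picardConst_pos (by positivity) (by positivity) n
  have h1 := h.abs_duhamel_le (hw.measurable_drift hB)
    (fun s y hs => hw.abs_drift_le hb y hs) (picardExp_gt hδ n) ht x
  have e : picardExp δ n + 1 = (n + 1) * (1 - δ) := by simp only [picardExp]; ring
  rw [e] at h1
  refine h1.trans ?_
  have h2 : 0 < 1 - δ := by linarith
  -- The denominator `(n + 1) (1 - δ)` is weakened to `1 - δ`.
  gcongr
  have : 0 ≤ (n : ℝ) * (1 - δ) := by positivity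
  linarith

end Estimates

end Picard

/-! ### Identification of the iterates with Picard sums, and convergence. -/

section Iterates

variable {H : Type*} [NormedAddCommGroup H] [InnerProductSpace ℝ H] [CompleteSpace H]

lemma inner_gradient (f : H → ℝ) (x v : H) : ⟪v, gradient f x⟫ = fderiv ℝ f x v := by
  rw [real_inner_comm]
  exact InnerProductSpace.toDual_symm_apply

lemma norm_gradient (f : H → ℝ) (x : H) : ‖gradient f x‖ = ‖fderiv ℝ f x‖ :=
  (InnerProductSpace.toDual ℝ H).symm.norm_map _

variable [SecondCountableTopology H] [MeasurableSpace H] [BorelSpace H]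

/-- The data of the iteration, with the smoothing property of the transition semigroup. -/
structure IterationData (S : ℝ → H →L[ℝ] H) (Q : H →L[ℝ] H) (B : H → H) (u₀ : H → ℝ)
    (δ C b M : ℝ) : Prop where
  smoothing : IsSmoothing (fun t x => posExt S t x) (noiseLaw S Q) δ C
  lt_one : δ < 1
  C_pos : 0 < C
  measurable_B : Measurable B
  b_pos : 0 < b
  norm_B_le : ∀ x, ‖B x‖ ≤ b
  measurable_u₀ : Measurable u₀
  M_pos : 0 < M
  abs_u₀_le : ∀ x, |u₀ x| ≤ M

/-- The terms of the series. -/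
noncomputable def seriesTerm (S : ℝ → H →L[ℝ] H) (Q : H →L[ℝ] H) (B : H → H) (u₀ : H → ℝ) :
    ℕ → ℝ → H → ℝ :=
  picard (fun t x => posExt S t x) (noiseLaw S Q) B u₀

variable {S : ℝ → H →L[ℝ] H} {Q : H →L[ℝ] H} {B : H → H} {u₀ : H → ℝ} {δ C b M : ℝ}

namespace IterationData

variable (h : IterationData S Q B u₀ δ C b M)
include h

lemma hasGradBound (n : ℕ) :
    HasGradBound (seriesTerm S Q B u₀ n) (picardConst δ (b * C) (M * C) n) (picardExp δ n) :=
  h.smoothing.hasGradBound_picard h.lt_one h.C_pos h.measurable_B h.b_pos h.norm_B_le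
    h.measurable_u₀ h.M_pos h.abs_u₀_le n

lemma abs_seriesTerm_zero_le (t : ℝ) (x : H) : |seriesTerm S Q B u₀ 0 t x| ≤ M :=
  h.smoothing.abs_avg_le h.abs_u₀_le t x

lemma abs_seriesTerm_succ_le (n : ℕ) {t : ℝ} (ht : 0 < t) (x : H) :
    |seriesTerm S Q B u₀ (n + 1) t x| ≤
      b * picardConst δ (b * C) (M * C) n * (t ^ ((n + 1) * (1 - δ)) / (1 - δ)) :=
  h.smoothing.abs_picard_succ_le h.lt_one h.C_pos h.measurable_B h.b_pos h.norm_B_le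
    h.measurable_u₀ h.M_pos h.abs_u₀_le n ht x

lemma exists_abs_seriesTerm_le (n : ℕ) {t : ℝ} (ht : 0 < t) :
    ∃ K, ∀ x, |seriesTerm S Q B u₀ n t x| ≤ K := by
  cases n with
  | zero => exact ⟨M, h.abs_seriesTerm_zero_le t⟩
  | succ n => exact ⟨_, h.abs_seriesTerm_succ_le n ht⟩

lemma differentiable_sum (s : Finset ℕ) {t : ℝ} (ht : 0 < t) :
    Differentiable ℝ fun x => ∑ k ∈ s, seriesTerm S Q B u₀ k t x :=
  Differentiable.fun_sum fun k _ => (h.hasGradBound k).differentiable t ht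

lemma fderiv_sum (s : Finset ℕ) {t : ℝ} (ht : 0 < t) (x : H) :
    fderiv ℝ (fun x => ∑ k ∈ s, seriesTerm S Q B u₀ k t x) x
      = ∑ k ∈ s, fderiv ℝ (seriesTerm S Q B u₀ k t) x :=
  fderiv_fun_sum fun k _ => (h.hasGradBound k).differentiable t ht x

lemma inner_gradient_sum (s : Finset ℕ) {t : ℝ} (ht : 0 < t) (y : H) :
    ⟪B y, gradient (fun x => ∑ k ∈ s, seriesTerm S Q B u₀ k t x) y⟫
      = ∑ k ∈ s, drift B (seriesTerm S Q B u₀ k) t y := by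
  rw [inner_gradient, h.fderiv_sum s ht, _root_.sum_apply]
  refine Finset.sum_congr rfl fun k _ => ?_
  rw [drift, Set.indicator_of_mem (Set.mem_Ioi.mpr ht)]

lemma measurable_drift (n : ℕ) :
    Measurable fun p : ℝ × H => drift B (seriesTerm S Q B u₀ n) p.1 p.2 :=
  (h.hasGradBound n).measurable_drift h.measurable_B

lemma measurable_drift_apply (n : ℕ) (t : ℝ) : Measurable (drift B (seriesTerm S Q B u₀ n) t) :=
  (h.measurable_drift n).comp (measurable_const.prodMk measurable_id)

lemma abs_drift_le (n : ℕ) (s : ℝ) (y : H) (hs : 0 < s) : |drift B (seriesTerm S Q B u₀ n) s y|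
    ≤ b * picardConst δ (b * C) (M * C) n * s ^ picardExp δ n :=
  (h.hasGradBound n).abs_drift_le h.norm_B_le y hs

/-- The integrand of the iteration splits into the integrands of the Picard terms. -/
lemma transition_drift_eq {n : ℕ} {s t : ℝ} (hs : s ∈ Set.Ioo 0 t) (x : H)
    (hsum : ∀ y, iterU S Q B u₀ n s y = ∑ k ∈ Finset.range (n + 1), seriesTerm S Q B u₀ k s y) :
    transition S Q (t - s) (fun y => ⟪B y, gradient (iterU S Q B u₀ n s) y⟫) x
      = ∑ k ∈ Finset.range (n + 1), avg (fun t x => posExt S t x) (noiseLaw S Q) (t - s)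
          (drift B (seriesTerm S Q B u₀ k) s) x := by
  rw [transition_eq (by linarith [hs.2]), funext hsum,
    ← h.smoothing.avg_sum _ (fun k => h.measurable_drift_apply k s)
      (fun k y => h.abs_drift_le k s y hs.1)]
  simp only [avg, h.inner_gradient_sum _ hs.1]

lemma integrableOn_avg_drift (k : ℕ) (t : ℝ) (x : H) :
    IntegrableOn (fun s => avg (fun t x => posExt S t x) (noiseLaw S Q) (t - s)
      (drift B (seriesTerm S Q B u₀ k) s) x) (Set.Ioo 0 t) :=
  h.smoothing.integrableOn_avg_sub (h.measurable_drift k) (h.abs_drift_le k)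
    (picardExp_gt h.lt_one k) t x

/-- The recursion is affine in the previous iterate. Regularity and integrability of the Picard
terms are already known, so gradient, average and time integral all commute with the finite sum, and
adding `w⁰` shifts the index by one. -/
lemma iterU_eq_sum (n : ℕ) : ∀ t, 0 ≤ t → ∀ x,
    iterU S Q B u₀ n t x = ∑ k ∈ Finset.range (n + 1), seriesTerm S Q B u₀ k t x := by
  induction n with
  | zero =>
    intro t ht x
    simp only [iterU, transition_eq ht, zero_add, Finset.range_one, Finset.sum_singleton]
    rfl
  | succ n ih =>
    intro t ht x
    simp only [iterU]
    rw [intervalIntegral.integral_of_le ht, integral_Ioc_eq_integral_Ioo,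
      setIntegral_congr_fun measurableSet_Ioo
        (fun s hs => h.transition_drift_eq hs x (ih s hs.1.le)),
      integral_finsetSum _ fun k _ => h.integrableOn_avg_drift k t x,
      Finset.sum_range_succ' _ (n + 1), add_comm, transition_eq ht]
    rfl

lemma iterV_eq (n : ℕ) {t : ℝ} (ht : 0 ≤ t) (x : H) :
    iterV S Q B u₀ n t x = seriesTerm S Q B u₀ n t x := by
  cases n with
  | zero => simp [iterV, h.iterU_eq_sum 0 t ht]
  | succ n =>
    change iterU S Q B u₀ (n + 1) t x - iterU S Q B u₀ n t x = _
    rw [h.iterU_eq_sum _ t ht, h.iterU_eq_sum _ t ht, Finset.sum_range_succ _ (n + 1),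
      add_sub_cancel_left]

lemma iterationWellPosed : IterationWellPosed S Q B u₀ := by
  have heq : ∀ n t, 0 < t → iterU S Q B u₀ n t
      = fun x => ∑ k ∈ Finset.range (n + 1), seriesTerm S Q B u₀ k t x :=
    fun n t ht => funext (h.iterU_eq_sum n t ht.le)
  refine ⟨fun n t ht => ⟨?_, ?_, ?_⟩, fun n t ht => ?_, fun n t ht => ?_, fun n t ht x => ?_⟩
  · rw [heq n t ht]
    exact h.differentiable_sum _ ht
  · choose K hK using fun k => h.exists_abs_seriesTerm_le k ht
    refine ⟨∑ k ∈ Finset.range (n + 1), K k, fun x => ?_⟩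
    rw [heq n t ht]
    exact (Finset.abs_sum_le_sum_abs _ _).trans (Finset.sum_le_sum fun k _ => hK k x)
  · refine ⟨∑ k ∈ Finset.range (n + 1), picardConst δ (b * C) (M * C) k * t ^ picardExp δ k,
      fun x => ?_⟩
    rw [heq n t ht, norm_gradient, h.fderiv_sum _ ht]
    exact (norm_sum_le _ _).trans
      (Finset.sum_le_sum fun k _ => (h.hasGradBound k).norm_fderiv_le t ht x)
  · simp only [heq n t ht, h.inner_gradient_sum _ ht]
    exact Finset.measurable_sum _ fun k _ => h.measurable_drift_apply k t
  · refine ⟨∑ k ∈ Finset.range (n + 1), b * picardConst δ (b * C) (M * C) k * t ^ picardExp δ k,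
      fun y => ?_⟩
    rw [heq n t ht, h.inner_gradient_sum _ ht]
    exact (Finset.abs_sum_le_sum_abs _ _).trans
      (Finset.sum_le_sum fun k _ => h.abs_drift_le k t y ht)
  · rw [intervalIntegrable_iff_integrableOn_Ioo_of_le ht.le]
    refine IntegrableOn.congr_fun (integrable_finsetSum (Finset.range (n + 1))
      fun k _ => h.integrableOn_avg_drift k t x) (fun s hs => ?_) measurableSet_Ioo
    exact (h.transition_drift_eq hs x (h.iterU_eq_sum n s hs.1.le)).symm

lemma summable_picardConst {r : ℝ} (hr : 0 < r) :
    Summable fun n => picardConst δ (b * C) (M * C) n * r ^ n :=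
  summable_picardConst_mul_pow h.lt_one (mul_pos h.b_pos h.C_pos) (mul_pos h.M_pos h.C_pos) hr

lemma picardConst_nonneg (n : ℕ) : 0 ≤ picardConst δ (b * C) (M * C) n :=
  (picardConst_pos (mul_pos h.b_pos h.C_pos) (mul_pos h.M_pos h.C_pos) n).le

lemma tendstoUniformlyOn_series {T : ℝ} (hT : 0 < T) :
    ∃ w : ℝ × H → ℝ, TendstoUniformlyOn
      (fun (N : ℕ) (p : ℝ × H) => ∑ n ∈ Finset.range N, iterV S Q B u₀ n p.1 p.2)
      w atTop (Set.Icc 0 T ×ˢ Set.univ) := by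
  have hα : 0 < 1 - δ := by linarith [h.lt_one]
  set r := T ^ (1 - δ)
  have hr : 0 < r := Real.rpow_pos_of_pos hT _
  let g : ℕ → ℝ := fun n => b * r / (1 - δ) * (picardConst δ (b * C) (M * C) n * r ^ n)
  -- The zeroth term is bounded by `M` alone; the term of index `n + 1` inherits its bound from the
  -- gradient constant of index `n`.
  let bound : ℕ → ℝ := fun n => Nat.casesOn n M g
  have hsum : Summable bound := by
    rw [← summable_nat_add_iff 1]
    exact (h.summable_picardConst hr).mul_left _
  refine ⟨_, tendstoUniformlyOn_tsum_nat hsum ?_⟩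
  rintro n ⟨t, x⟩ ⟨⟨ht0, htT⟩, -⟩
  simp only at ht0 htT ⊢
  rw [h.iterV_eq n ht0, Real.norm_eq_abs]
  cases n with
  | zero => exact h.abs_seriesTerm_zero_le t x
  | succ n =>
    change |_| ≤ g n
    have hg : g n = b * picardConst δ (b * C) (M * C) n * (T ^ ((n + 1) * (1 - δ)) / (1 - δ)) := by
      have e : T ^ (((n : ℝ) + 1) * (1 - δ)) = r ^ n * r := by
        rw [mul_comm, Real.rpow_mul hT.le, ← pow_succ, ← Real.rpow_natCast]
        push_cast
        rfl
      simp only [g]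
      rw [e]
      ring
    rw [hg]
    have hb := h.b_pos.le
    have ha := h.picardConst_nonneg n
    rcases ht0.eq_or_lt with rfl | ht
    · have h0 : seriesTerm S Q B u₀ (n + 1) 0 x = 0 := by
        simp [seriesTerm, picard, duhamel]
      rw [h0, abs_zero]
      positivity
    · refine (h.abs_seriesTerm_succ_le n ht x).trans ?_
      have : 0 ≤ ((n : ℝ) + 1) * (1 - δ) := by positivity
      gcongr

lemma tendstoUniformlyOn_gradient {t₀ T : ℝ} (ht₀ : 0 < t₀) (hT : t₀ < T) :
    ∃ g : ℝ × H → H, TendstoUniformlyOn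
      (fun (N : ℕ) (p : ℝ × H) => ∑ n ∈ Finset.range N, gradient (iterV S Q B u₀ n p.1) p.2)
      g atTop (Set.Icc t₀ T ×ˢ Set.univ) := by
  have hT0 : 0 < T := ht₀.trans hT
  have hα : 0 < 1 - δ := by linarith [h.lt_one]
  set r := T ^ (1 - δ)
  have hr : 0 < r := Real.rpow_pos_of_pos hT0 _
  -- The function `t ^ (-δ)` is monotone on `[t₀, T]`, in a direction set by the sign of `δ`, so its
  -- larger endpoint value bounds it.
  set c := max (t₀ ^ (-δ)) (T ^ (-δ))
  refine ⟨_, tendstoUniformlyOn_tsum_nat ((h.summable_picardConst hr).mul_left c) ?_⟩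
  rintro n ⟨t, x⟩ ⟨⟨ht1, htT⟩, -⟩
  simp only at ht1 htT ⊢
  have ht : 0 < t := ht₀.trans_le ht1
  rw [funext (h.iterV_eq n ht.le), norm_gradient]
  refine ((h.hasGradBound n).norm_fderiv_le t ht x).trans ?_
  have hc : t ^ (-δ) ≤ c := by
    rcases le_total 0 (-δ) with hd | hd
    · exact (Real.rpow_le_rpow ht.le htT hd).trans (le_max_right _ _)
    · exact (Real.rpow_le_rpow_of_nonpos ht₀ ht1 hd).trans (le_max_left _ _)
  have e : t ^ picardExp δ n = t ^ (-δ) * (t ^ (1 - δ)) ^ n := by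
    rw [picardExp, Real.rpow_add ht, mul_comm (n : ℝ), Real.rpow_mul ht.le, Real.rpow_natCast]
  have hp : (t ^ (1 - δ)) ^ n ≤ r ^ n :=
    pow_le_pow_left₀ (Real.rpow_nonneg ht.le _) (Real.rpow_le_rpow ht.le htT hα.le) n
  have ha := h.picardConst_nonneg n
  have h1 : t ^ (-δ) * (t ^ (1 - δ)) ^ n ≤ c * r ^ n :=
    mul_le_mul hc hp (pow_nonneg (Real.rpow_nonneg ht.le _) _)
      ((Real.rpow_nonneg ht.le _).trans hc)
  rw [e]
  calc picardConst δ (b * C) (M * C) n * (t ^ (-δ) * (t ^ (1 - δ)) ^ n)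
      ≤ picardConst δ (b * C) (M * C) n * (c * r ^ n) := by gcongr
    _ = c * (picardConst δ (b * C) (M * C) n * r ^ n) := by ring

end IterationData

lemma IsC0Semigroup.isSmoothing (hS : IsC0Semigroup S) (hQ : Q.IsPositive)
    (hQtr : ∀ t : ℝ, 0 < t → IsTraceClass (covOp S Q t))
    (hrange : ∀ t : ℝ, 0 < t → Set.range (S t) ⊆ Set.range (opSqrt (covOp S Q t)))
    (hC : 0 < C) (hLam : ∀ t : ℝ, 0 < t → ∀ x : H, ‖Lam S Q t x‖ ≤ C / t ^ δ * ‖x‖) :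
    IsSmoothing (fun t x => posExt S t x) (noiseLaw S Q) δ C where
  measurable_flow := hS.measurable_posExt
  isProbabilityMeasure := hS.isProbabilityMeasure_noiseLaw hQ hQtr
  measurable_law := hS.measurable_noiseLaw hQ hQtr
  smoothing _ ht _ hf _ hM x := hS.hasFDerivAt_transition hQ hQtr hrange hC hLam ht hf hM x

end Iterates

end KolmogorovSeries

theorem mainTheorem5 {H : Type*} [NormedAddCommGroup H] [InnerProductSpace ℝ H] [CompleteSpace H]
    [TopologicalSpace.SeparableSpace H] [MeasurableSpace H] [BorelSpace H]
    (A : H →ₗ.[ℝ] H) (S : ℝ → H →L[ℝ] H) (Q : H →L[ℝ] H)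
    (hS : KolmogorovSeries.IsC0Semigroup S)
    (hA : KolmogorovSeries.IsInfinitesimalGenerator A S)
    (hQ : Q.IsPositive) (hQker : ∀ x : H, Q x = 0 → x = 0)
    (hQtr : ∀ t : ℝ, 0 < t → KolmogorovSeries.IsTraceClass (KolmogorovSeries.covOp S Q t))
    (hrange : ∀ t : ℝ, 0 < t → Set.range (S t) ⊆
      Set.range (KolmogorovSeries.opSqrt (KolmogorovSeries.covOp S Q t)))
    (δ C : ℝ) (hδ0 : 0 < δ) (hδ1 : δ < 1) (hC : 0 < C)
    (hLam : ∀ t : ℝ, 0 < t → ∀ x : H, ‖KolmogorovSeries.Lam S Q t x‖ ≤ C / t ^ δ * ‖x‖)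
    (B : H → H) (hBm : Measurable B) (hBb : ∃ M : ℝ, ∀ x, ‖B x‖ ≤ M)
    (u₀ : H → ℝ) (hum : Measurable u₀) (hub : ∃ M : ℝ, ∀ x, |u₀ x| ≤ M) :
    KolmogorovSeries.IterationWellPosed S Q B u₀ ∧
    ∀ T : ℝ, 0 < T →
      (∃ w : ℝ × H → ℝ, TendstoUniformlyOn
        (fun (N : ℕ) (p : ℝ × H) =>
          ∑ n ∈ Finset.range N, KolmogorovSeries.iterV S Q B u₀ n p.1 p.2)
        w atTop (Set.Icc 0 T ×ˢ Set.univ)) ∧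
      ∀ t₀ : ℝ, 0 < t₀ → t₀ < T →
        ∃ g : ℝ × H → H, TendstoUniformlyOn
          (fun (N : ℕ) (p : ℝ × H) =>
            ∑ n ∈ Finset.range N, gradient (KolmogorovSeries.iterV S Q B u₀ n p.1) p.2)
          g atTop (Set.Icc t₀ T ×ˢ Set.univ) := by
  have := UniformSpace.secondCountable_of_separable H
  obtain ⟨b, hb⟩ := hBb
  obtain ⟨M, hM⟩ := hub
  -- Taking the maximum with `1` makes the bounds strictly positive, which keeps the Picard
  -- constants positive.
  have h : KolmogorovSeries.IterationData S Q B u₀ δ C (max b 1) (max M 1) :=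
    { smoothing := hS.isSmoothing hQ hQtr hrange hC hLam
      lt_one := hδ1
      C_pos := hC
      measurable_B := hBm
      b_pos := lt_max_of_lt_right one_pos
      norm_B_le := fun x => (hb x).trans (le_max_left _ _)
      measurable_u₀ := hum
      M_pos := lt_max_of_lt_right one_pos
      abs_u₀_le := fun x => (hM x).trans (le_max_left _ _) }
  exact ⟨h.iterationWellPosed, fun T hT =>
    ⟨h.tendstoUniformlyOn_series hT, fun t₀ ht₀ hT₀ => h.tendstoUniformlyOn_gradient ht₀ hT₀⟩⟩
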